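/- Let $\mathbb N=\{1,2,3,\dots\}$ and $\mathbb T=\mathbb R/\mathbb Z$; an interval means a nonempty finite set of consecutive integers, and its length is its number of elements. For $S\subset\mathbb N$ let $\Delta(S)=\{b-a : a,b\in S,\ b>a\}$. A set $A\subset\mathbb Z$ (for instance $A\subset\mathbb N$) is a $\Delta^*$-set if $A\cap\Delta(S)\neq\emptyset$ for every infinite $S\subset\mathbb N$. A set $\Lambda\subset\mathbb Z$ is a $\mathrm{Bohr}_0$-set if there exist $m\in\mathbb N$, $\alpha\in\mathbb T^m$ and an open set $U\subset\mathbb T^m$ with $0\in U$ such that $\{n\in\mathbb Z : n\alpha\in U\}\subset\Lambda$. Theorem. Every $\Delta^*$-set $A$ is a strongly piecewise $\mathrm{Bohr}_0$-set, in the following sense: for every sequence $(J_k)_{k\ge 1}$ of intervals contained in $\mathbb N$ whose lengths tend to infinity, there exist a sequence $(I_j)_{j\ge 1}$ of intervals and a $\mathrm{Bohr}_0$-set $\Lambda$ (which may depend on $(J_k)$) such that 1. for each $j$ there is some $k$ with $I_j\subset J_k$; 2. the lengths $|I_j|$ tend to infinity; 3. $\Lambda\cap I_j\subset A$ for every $j\ge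 1$. -/

import Mathlib

/-- `A ⊆ ℤ` is a `Bohr₀`-set: it contains `{n ∈ ℤ : n α ∈ U}` for some `α ∈ 𝕋^m` and some open
`U ⊆ 𝕋^m` with `0 ∈ U`. -/
def IsBohrZero (A : Set ℤ) : Prop :=
  ∃ (m : ℕ) (α : Fin m → UnitAddCircle) (U : Set (Fin m → UnitAddCircle)),
    IsOpen U ∧ 0 ∈ U ∧ {n : ℤ | n • α ∈ U} ⊆ A

/-- A nonempty finite interval of positive integers. -/
def IsPosInterval (I : Finset ℤ) : Prop :=
  ∃ a b : ℤ, 0 < a ∧ a ≤ b ∧ I = Finset.Icc a b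

/-- `A` is strongly piecewise-`F`: every sequence `J` of intervals whose lengths tend to infinity
has a sequence `I` of subintervals, with lengths tending to infinity, on all of which `A` contains
one and the same member of `F`. All intervals are intervals of positive integers. -/
def IsStronglyPiecewise (F : Set ℤ → Prop) (A : Set ℤ) : Prop :=
  ∀ J : ℕ → Finset ℤ, (∀ k, IsPosInterval (J k)) →
    Filter.Tendsto (fun k => (J k).card) Filter.atTop Filter.atTop →
    ∃ I : ℕ → Finset ℤ, (∀ j, IsPosInterval (I j)) ∧
      (∀ j, ∃ k, I j ⊆ J k) ∧
      Filter.Tendsto (fun j => (I j).card) Filter.atTop Filter.atTop ∧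
      ∃ Λ : Set ℤ, F Λ ∧ ∀ j, Λ ∩ (I j : Set ℤ) ⊆ A

/-- The difference set `Δ(S) = {b - a : a, b ∈ S, a < b}`. -/
def differenceSet (S : Set ℤ) : Set ℤ :=
  {n | ∃ a ∈ S, ∃ b ∈ S, a < b ∧ n = b - a}

/-- `A` is a `Δ^*`-set: it meets `Δ(S)` for every infinite set `S` of positive integers. -/
def IsDeltaStar (A : Set ℤ) : Prop :=
  ∀ S : Set ℤ, S ⊆ Set.Ioi 0 → S.Infinite → (A ∩ differenceSet S).Nonempty

open Filter Topology MeasureTheory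

/-- A bounded real sequence indexed by `ℤ`. -/
def IsBddSeq (u : ℤ → ℝ) : Prop := ∃ C, ∀ n, |u n| ≤ C

namespace IsBddSeq

variable {u v : ℤ → ℝ}

theorem exists_pos (hu : IsBddSeq u) : ∃ C, 0 < C ∧ ∀ n, |u n| ≤ C := by
  obtain ⟨C, hC⟩ := hu
  exact ⟨max C 1, by positivity, fun n => (hC n).trans (le_max_left _ _)⟩

theorem const (c : ℝ) : IsBddSeq fun _ => c := ⟨|c|, fun _ => le_rfl⟩

theorem add (hu : IsBddSeq u) (hv : IsBddSeq v) : IsBddSeq fun n => u n + v n := by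
  obtain ⟨C, hC⟩ := hu
  obtain ⟨D, hD⟩ := hv
  exact ⟨C + D, fun n => (abs_add_le _ _).trans (add_le_add (hC n) (hD n))⟩

theorem mul (hu : IsBddSeq u) (hv : IsBddSeq v) : IsBddSeq fun n => u n * v n := by
  obtain ⟨C, hC0, hC⟩ := hu.exists_pos
  obtain ⟨D, hD⟩ := hv
  exact ⟨C * D, fun n => by
    rw [abs_mul]; exact mul_le_mul (hC n) (hD n) (abs_nonneg _) hC0.le⟩

theorem const_mul (c : ℝ) (hu : IsBddSeq u) : IsBddSeq fun n => c * u n :=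
  (const c).mul hu

theorem neg (hu : IsBddSeq u) : IsBddSeq fun n => -u n := by
  obtain ⟨C, hC⟩ := hu
  exact ⟨C, fun n => by simpa using hC n⟩

theorem sub (hu : IsBddSeq u) (hv : IsBddSeq v) : IsBddSeq fun n => u n - v n := by
  simpa [sub_eq_add_neg] using hu.add hv.neg

theorem sq (hu : IsBddSeq u) : IsBddSeq fun n => u n ^ 2 := by
  simpa [pow_two] using hu.mul hu

theorem abs (hu : IsBddSeq u) : IsBddSeq fun n => |u n| := by
  obtain ⟨C, hC⟩ := hu
  exact ⟨C, fun n => by simpa using hC n⟩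

theorem comp (hu : IsBddSeq u) (φ : ℤ → ℤ) : IsBddSeq fun n => u (φ n) := by
  obtain ⟨C, hC⟩ := hu
  exact ⟨C, fun n => hC _⟩

theorem sum {ι : Type*} (s : Finset ι) {w : ι → ℤ → ℝ} (hw : ∀ i ∈ s, IsBddSeq (w i)) :
    IsBddSeq fun n => ∑ i ∈ s, w i n := by
  classical
  induction s using Finset.induction_on with
  | empty => simpa using const 0
  | insert a s ha ih =>
    simp only [Finset.sum_insert ha]
    exact (hw a (by simp)).add (ih fun i hi => hw i (by simp [hi]))

theorem indicator (S : Set ℤ) : IsBddSeq (S.indicator 1) := by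
  refine ⟨1, fun n => ?_⟩
  by_cases h : n ∈ S <;> simp [h]

end IsBddSeq

/-- The submodule of bounded sequences. -/
def bddSeq : Submodule ℝ (ℤ → ℝ) where
  carrier := {u | IsBddSeq u}
  add_mem' hu hv := hu.add hv
  zero_mem' := IsBddSeq.const 0
  smul_mem' c _ hu := hu.const_mul c

/-- The average of `u` over the finite set `J`. -/
noncomputable def finsetAvg (J : Finset ℤ) (u : ℤ → ℝ) : ℝ := (∑ n ∈ J, u n) / J.card

theorem abs_finsetAvg_le {J : Finset ℤ} {u : ℤ → ℝ} {C : ℝ} (hC0 : 0 ≤ C) (hC : ∀ n, |u n| ≤ C) :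
    |finsetAvg J u| ≤ C := by
  unfold finsetAvg
  rw [abs_div, Nat.abs_cast]
  apply div_le_of_le_mul₀ (Nat.cast_nonneg _) hC0
  calc |∑ n ∈ J, u n| ≤ ∑ n ∈ J, |u n| := Finset.abs_sum_le_sum_abs _ _
    _ ≤ ∑ n ∈ J, C := Finset.sum_le_sum fun n _ => hC n
    _ = C * J.card := by simp [mul_comm]

/-- A linear functional that is positive and shift-invariant on bounded sequences, normalized, and
approximable by averages over finite sets. -/
structure IsInvMean (M : (ℤ → ℝ) →ₗ[ℝ] ℝ) : Prop where
  nonneg : ∀ u, IsBddSeq u → (∀ n, 0 ≤ u n) → 0 ≤ M u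
  const_one : M (fun _ => 1) = 1
  shift : ∀ u, IsBddSeq u → ∀ a : ℤ, M (fun n => u (n + a)) = M u
  approx : ∀ S : Finset (ℤ → ℝ), (∀ u ∈ S, IsBddSeq u) → ∀ ε > 0,
    ∃ J : Finset ℤ, ∀ u ∈ S, |finsetAvg J u - M u| ≤ ε

/-- Ultrafilter limits of averages define a linear functional. -/
theorem exists_linearMap_tendsto_finsetAvg (J : ℕ → Finset ℤ) (U : Ultrafilter ℕ) :
    ∃ M : (ℤ → ℝ) →ₗ[ℝ] ℝ, ∀ u, IsBddSeq u →
      Tendsto (fun k => finsetAvg (J k) u) U (𝓝 (M u)) := by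
  have hlim : ∀ u : bddSeq, ∃ x, Tendsto (fun k => finsetAvg (J k) u) U (𝓝 x) := by
    rintro ⟨u, hu⟩
    obtain ⟨C, hC0, hC⟩ := IsBddSeq.exists_pos hu
    obtain ⟨x, -, hx⟩ := (isCompact_Icc (a := -C) (b := C)).ultrafilter_le_nhds
      (U.map fun k => finsetAvg (J k) u) (by
        simp only [Ultrafilter.coe_map, le_principal_iff, mem_map]
        exact Filter.univ_mem' fun k => abs_le.1 (abs_finsetAvg_le hC0.le hC))
    exact ⟨x, hx⟩
  choose m hm using hlim
  let M0 : bddSeq →ₗ[ℝ] ℝ :=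
    { toFun := m
      map_add' := fun u v => by
        refine tendsto_nhds_unique (hm (u + v)) (((hm u).add (hm v)).congr fun k => ?_)
        simp [finsetAvg, Finset.sum_add_distrib, add_div]
      map_smul' := fun c u => by
        refine tendsto_nhds_unique (hm (c • u)) (((hm u).const_mul c).congr fun k => ?_)
        simp [finsetAvg, ← Finset.mul_sum, mul_div_assoc] }
  obtain ⟨M, hM⟩ := M0.exists_extend
  refine ⟨M, fun u hu => ?_⟩
  have : M u = m ⟨u, hu⟩ := LinearMap.congr_fun hM ⟨u, hu⟩
  rw [this]
  exact hm ⟨u, hu⟩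

theorem sum_Icc_shift_sub (u : ℤ → ℝ) (a : ℤ) (k : ℕ) :
    ∑ n ∈ Finset.Icc a (a + k), u (n + 1) - ∑ n ∈ Finset.Icc a (a + k), u n
      = u (a + k + 1) - u a := by
  induction k with
  | zero => simp
  | succ k ih =>
    have h : Finset.Icc a (a + (k + 1 : ℕ)) = insert (a + (k + 1 : ℕ)) (Finset.Icc a (a + k)) := by
      ext x; simp; omega
    rw [h, Finset.sum_insert (by simp), Finset.sum_insert (by simp)]
    push_cast at ih ⊢
    simp only [← add_assoc] at ih ⊢
    linarith

/-- Along intervals with lengths tending to infinity there is an invariant mean which only sees the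
points deep inside the intervals. -/
theorem exists_isInvMean (J : ℕ → Finset ℤ) (hJ : ∀ k, IsPosInterval (J k))
    (hcard : Tendsto (fun k => (J k).card) atTop atTop) :
    ∃ M : (ℤ → ℝ) →ₗ[ℝ] ℝ, IsInvMean M ∧ ∀ (R : ℕ) (u : ℤ → ℝ), IsBddSeq u →
      (∀ n : ℤ, (∃ k, Finset.Icc (n - R) (n + R) ⊆ J k) → 0 ≤ u n) → 0 ≤ M u := by
  obtain ⟨M, hM⟩ := exists_linearMap_tendsto_finsetAvg J (hyperfilter ℕ)
  have hU : ((hyperfilter ℕ : Ultrafilter ℕ) : Filter ℕ) ≤ atTop := by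
    rw [← Nat.cofinite_eq_atTop]; exact hyperfilter_le_cofinite
  have hcardR : Tendsto (fun k => ((J k).card : ℝ)) (hyperfilter ℕ : Ultrafilter ℕ) atTop :=
    (tendsto_natCast_atTop_atTop.comp hcard).mono_left hU
  have hpos : ∀ k, 0 < (J k).card := by
    intro k
    obtain ⟨a, b, -, hab, h⟩ := hJ k
    rw [h, Finset.card_pos]
    exact Finset.nonempty_Icc.2 hab
  have hdeep : ∀ (R : ℕ) (u : ℤ → ℝ), IsBddSeq u →
      (∀ n : ℤ, (∃ k, Finset.Icc (n - R) (n + R) ⊆ J k) → 0 ≤ u n) → 0 ≤ M u := by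
    intro R u hu h
    obtain ⟨C, hC0, hC⟩ := hu.exists_pos
    have h0 : Tendsto (fun k => -(C * (2 * R)) / ((J k).card : ℝ))
        (hyperfilter ℕ : Ultrafilter ℕ) (𝓝 0) := hcardR.const_div_atTop _
    refine le_of_tendsto_of_tendsto' h0 (hM u hu) fun k => ?_
    refine div_le_div_of_nonneg_right ?_ (Nat.cast_nonneg _)
    obtain ⟨a, b, -, hab, hk⟩ := hJ k
    have hsub : (J k).filter (fun n : ℤ => ¬ Finset.Icc (n - R) (n + R) ⊆ J k) ⊆
        Finset.Ico a (a + R) ∪ Finset.Ioc (b - R) b := by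
      intro n hn
      rw [Finset.mem_filter, hk, Finset.mem_Icc] at hn
      simp only [Finset.mem_union, Finset.mem_Ico, Finset.mem_Ioc]
      by_contra hcon
      exact hn.2 (Finset.Icc_subset_Icc (by omega) (by omega))
    have hc : (((J k).filter (fun n : ℤ => ¬ Finset.Icc (n - R) (n + R) ⊆ J k)).card : ℝ) ≤ 2 * R := by
      have := (Finset.card_le_card hsub).trans (Finset.card_union_le _ _)
      simp only [Int.card_Ico, Int.card_Ioc] at this
      have h2 : ((J k).filter (fun n : ℤ => ¬ Finset.Icc (n - R) (n + R) ⊆ J k)).card ≤ 2 * R := by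
        omega
      exact_mod_cast h2
    rw [← Finset.sum_filter_add_sum_filter_not (J k)
      (fun n : ℤ => Finset.Icc (n - R) (n + R) ⊆ J k)]
    have h1 : 0 ≤ ∑ n ∈ (J k).filter (fun n : ℤ => Finset.Icc (n - R) (n + R) ⊆ J k), u n :=
      Finset.sum_nonneg fun n hn => h n ⟨k, (Finset.mem_filter.1 hn).2⟩
    have h2 : ∑ n ∈ (J k).filter (fun n : ℤ => ¬ Finset.Icc (n - R) (n + R) ⊆ J k), (-C) ≤
        ∑ n ∈ (J k).filter (fun n : ℤ => ¬ Finset.Icc (n - R) (n + R) ⊆ J k), u n :=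
      Finset.sum_le_sum fun n _ => (abs_le.1 (hC n)).1
    rw [Finset.sum_const, nsmul_eq_mul] at h2
    nlinarith
  have hshift : ∀ u, IsBddSeq u → M (fun n => u (n + 1)) = M u := by
    intro u hu
    obtain ⟨C, hC0, hC⟩ := hu.exists_pos
    have h1 := (hM _ (hu.comp (· + 1))).sub (hM u hu)
    have h0 : Tendsto (fun k => finsetAvg (J k) (fun n => u (n + 1)) - finsetAvg (J k) u)
        (hyperfilter ℕ : Ultrafilter ℕ) (𝓝 0) := by
      refine squeeze_zero_norm (fun k => ?_) (hcardR.const_div_atTop (2 * C))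
      obtain ⟨a, b, -, hab, hk⟩ := hJ k
      obtain ⟨m, rfl⟩ := Int.le.dest hab
      rw [finsetAvg, finsetAvg, ← sub_div, hk, sum_Icc_shift_sub, norm_div, Real.norm_eq_abs,
        Real.norm_eq_abs, Nat.abs_cast]
      refine div_le_div_of_nonneg_right ?_ (Nat.cast_nonneg _)
      have e1 := abs_le.1 (hC (a + m + 1))
      have e2 := abs_le.1 (hC a)
      rw [abs_le]; constructor <;> linarith
    exact sub_eq_zero.1 (tendsto_nhds_unique h1 h0)
  refine ⟨M, ⟨fun u hu h => hdeep 0 u hu fun n _ => h n, ?_, ?_, ?_⟩, hdeep⟩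
  · refine tendsto_nhds_unique (hM _ (IsBddSeq.const 1)) ?_
    refine tendsto_const_nhds.congr fun k => ?_
    have := hpos k
    simp only [finsetAvg, Finset.sum_const, nsmul_eq_mul, mul_one]
    rw [div_self]; positivity
  · intro u hu a
    induction a using Int.induction_on with
    | zero => simp
    | succ i ih =>
      rw [← ih, ← hshift _ (hu.comp (· + (i : ℤ)))]
      congr 1; funext n; congr 1; ring
    | pred i ih =>
      rw [← ih, ← hshift _ (hu.comp (· + (-(i : ℤ) - 1)))]
      congr 1; funext n; congr 1; ring
  · intro S hS ε hε
    have : ∀ᶠ k in (hyperfilter ℕ : Ultrafilter ℕ), ∀ u ∈ S, |finsetAvg (J k) u - M u| ≤ ε := by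
      rw [Filter.eventually_all_finset]
      intro u hu
      filter_upwards [Metric.tendsto_nhds.1 (hM u (hS u hu)) ε hε] with k hk
      exact (Real.dist_eq _ _ ▸ hk).le
    obtain ⟨k, hk⟩ := this.exists
    exact ⟨J k, hk⟩

namespace IsInvMean

variable {M : (ℤ → ℝ) →ₗ[ℝ] ℝ} {u v : ℤ → ℝ}

theorem map_add (M : (ℤ → ℝ) →ₗ[ℝ] ℝ) (u v : ℤ → ℝ) :
    M (fun n => u n + v n) = M u + M v := M.map_add u v

theorem map_sub (M : (ℤ → ℝ) →ₗ[ℝ] ℝ) (u v : ℤ → ℝ) :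
    M (fun n => u n - v n) = M u - M v := M.map_sub u v

theorem map_const_mul (M : (ℤ → ℝ) →ₗ[ℝ] ℝ) (c : ℝ) (u : ℤ → ℝ) :
    M (fun n => c * u n) = c * M u := M.map_smul c u

theorem map_mul_const (M : (ℤ → ℝ) →ₗ[ℝ] ℝ) (c : ℝ) (u : ℤ → ℝ) :
    M (fun n => u n * c) = M u * c := by
  simp only [mul_comm _ c]; exact M.map_smul c u

theorem map_sum {ι : Type*} (M : (ℤ → ℝ) →ₗ[ℝ] ℝ) (s : Finset ι) (w : ι → ℤ → ℝ) :
    M (fun n => ∑ i ∈ s, w i n) = ∑ i ∈ s, M (w i) := by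
  rw [← _root_.map_sum]; congr 1; funext n; simp

theorem map_const (hM : IsInvMean M) (c : ℝ) : M (fun _ => c) = c := by
  have := map_const_mul M c (fun _ => 1)
  simpa [hM.const_one] using this

theorem mono (hM : IsInvMean M) (hu : IsBddSeq u) (hv : IsBddSeq v) (h : ∀ n, u n ≤ v n) :
    M u ≤ M v := by
  have := hM.nonneg _ (hv.sub hu) fun n => sub_nonneg.2 (h n)
  rw [map_sub] at this
  linarith

theorem abs_le (hM : IsInvMean M) {C : ℝ} (hC : ∀ n, |u n| ≤ C) : |M u| ≤ C := by
  have hu : IsBddSeq u := ⟨C, hC⟩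
  rw [_root_.abs_le]
  constructor
  · rw [← hM.map_const (-C)]
    exact hM.mono (.const _) hu fun n => (_root_.abs_le.1 (hC n)).1
  · rw [← hM.map_const C]
    exact hM.mono hu (.const _) fun n => (_root_.abs_le.1 (hC n)).2

theorem abs_map_le (hM : IsInvMean M) (hu : IsBddSeq u) : |M u| ≤ M fun n => |u n| := by
  rw [_root_.abs_le]
  constructor
  · have := hM.mono hu.neg hu.abs fun n => neg_le_abs _
    have e : M (fun n => -u n) = -M u := M.map_neg u
    linarith
  · exact hM.mono hu hu.abs fun n => le_abs_self _

/-- The Cauchy–Schwarz inequality for a mean. -/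
theorem sq_map_mul_le (hM : IsInvMean M) (hu : IsBddSeq u) (hv : IsBddSeq v) :
    M (fun n => u n * v n) ^ 2 ≤ M (fun n => u n ^ 2) * M fun n => v n ^ 2 := by
  have key : ∀ x : ℝ, 0 ≤ M (fun n => v n ^ 2) * (x * x) + (2 * M fun n => u n * v n) * x +
      M fun n => u n ^ 2 := by
    intro x
    have h := hM.nonneg (fun n => (u n + x * v n) ^ 2) (hu.add (hv.const_mul x)).sq
      fun n => sq_nonneg _
    have e : (fun n => (u n + x * v n) ^ 2) =
        fun n => (u n ^ 2 + (2 * x) * (u n * v n)) + (x * x) * v n ^ 2 := by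
      funext n; ring
    rw [e, map_add, map_add, map_const_mul, map_const_mul] at h
    linarith
  have := discrim_le_zero key
  unfold discrim at this
  linarith

theorem sq_map_le (hM : IsInvMean M) (hu : IsBddSeq u) : M u ^ 2 ≤ M fun n => u n ^ 2 := by
  have := hM.sq_map_mul_le hu (.const 1)
  simpa [hM.const_one] using this

/-- A mean is bounded by the supremum of window averages. -/
theorem le_of_window_le (hM : IsInvMean M) (hu : IsBddSeq u) {R : ℕ} (hR : 0 < R) {κ : ℝ}
    (h : ∀ n : ℤ, ∑ i ∈ Finset.range R, u (n + i) ≤ R * κ) : M u ≤ κ := by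
  have h1 : M (fun n => ∑ i ∈ Finset.range R, u (n + i)) = R * M u := by
    rw [map_sum M (Finset.range R) (fun i n => u (n + i))]
    simp [hM.shift u hu]
  have h2 := hM.mono (.sum (Finset.range R) fun i _ => hu.comp (· + (i : ℤ))) (.const (R * κ)) h
  rw [hM.map_const, h1] at h2
  exact le_of_mul_le_mul_left h2 (by positivity)

theorem isBddSeq_map (hM : IsInvMean M) {w : ℤ → ℤ → ℝ} (C : ℝ) (h : ∀ s n, |w s n| ≤ C) :
    IsBddSeq fun s => M (w s) :=
  ⟨C, fun s => hM.abs_le (h s)⟩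

end IsInvMean

/-- The real part of the character `n ↦ e(nθ)`. -/
noncomputable def cosChar (θ : UnitAddCircle) (n : ℤ) : ℝ := (fourier n θ).re

/-- The imaginary part of the character `n ↦ e(nθ)`. -/
noncomputable def sinChar (θ : UnitAddCircle) (n : ℤ) : ℝ := (fourier n θ).im

theorem norm_fourier_apply (n : ℤ) (θ : UnitAddCircle) : ‖fourier n θ‖ = 1 := by
  rw [fourier_apply, Circle.norm_coe]

theorem abs_cosChar_le (θ : UnitAddCircle) (n : ℤ) : |cosChar θ n| ≤ 1 :=
  (Complex.abs_re_le_norm _).trans (norm_fourier_apply n θ).le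

theorem abs_sinChar_le (θ : UnitAddCircle) (n : ℤ) : |sinChar θ n| ≤ 1 :=
  (Complex.abs_im_le_norm _).trans (norm_fourier_apply n θ).le

theorem cosChar_neg (θ : UnitAddCircle) (n : ℤ) : cosChar θ (-n) = cosChar θ n := by
  simp [cosChar]

theorem cosChar_sub (θ : UnitAddCircle) (m n : ℤ) :
    cosChar θ (m - n) = cosChar θ m * cosChar θ n + sinChar θ m * sinChar θ n := by
  rw [cosChar, sub_eq_add_neg, fourier_add, fourier_neg]
  simp [cosChar, sinChar]

/-- Real trigonometric polynomials on `ℤ`. -/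
noncomputable def trigPoly : Submodule ℝ (ℤ → ℝ) :=
  Submodule.span ℝ (Set.range cosChar ∪ Set.range sinChar)

theorem cosChar_mem_trigPoly (θ : UnitAddCircle) : cosChar θ ∈ trigPoly :=
  Submodule.subset_span (Or.inl ⟨θ, rfl⟩)

theorem sinChar_mem_trigPoly (θ : UnitAddCircle) : sinChar θ ∈ trigPoly :=
  Submodule.subset_span (Or.inr ⟨θ, rfl⟩)

theorem const_mem_trigPoly (c : ℝ) : (fun _ => c) ∈ trigPoly := by
  have h : (fun _ : ℤ => c) = c • cosChar 0 := by
    funext n; simp [cosChar, fourier_apply]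
  rw [h]
  exact Submodule.smul_mem _ _ (cosChar_mem_trigPoly 0)

theorem isBddSeq_of_mem_trigPoly {p : ℤ → ℝ} (hp : p ∈ trigPoly) : IsBddSeq p := by
  have : trigPoly ≤ bddSeq := by
    refine Submodule.span_le.2 ?_
    rintro _ (⟨θ, rfl⟩ | ⟨θ, rfl⟩)
    · exact ⟨1, abs_cosChar_le θ⟩
    · exact ⟨1, abs_sinChar_le θ⟩
  exact this hp

theorem IsBohrZero.mono {A B : Set ℤ} (hA : IsBohrZero A) (h : A ⊆ B) : IsBohrZero B := by
  obtain ⟨m, α, U, hU, h0, hs⟩ := hA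
  exact ⟨m, α, U, hU, h0, hs.trans h⟩

theorem IsBohrZero.univ : IsBohrZero Set.univ :=
  ⟨0, 0, Set.univ, isOpen_univ, trivial, Set.subset_univ _⟩

theorem IsBohrZero.inter {A B : Set ℤ} (hA : IsBohrZero A) (hB : IsBohrZero B) :
    IsBohrZero (A ∩ B) := by
  obtain ⟨m, α, U, hU, hU0, hUA⟩ := hA
  obtain ⟨l, β, V, hV, hV0, hVB⟩ := hB
  refine ⟨m + l, Fin.append α β,
    (fun x i => x (Fin.castAdd l i)) ⁻¹' U ∩ (fun x i => x (Fin.natAdd m i)) ⁻¹' V,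
    (hU.preimage (by fun_prop)).inter (hV.preimage (by fun_prop)), ⟨hU0, hV0⟩, ?_⟩
  rintro n ⟨h1, h2⟩
  refine ⟨hUA ?_, hVB ?_⟩
  · have e : (fun i => (n • Fin.append α β) (Fin.castAdd l i)) = n • α := by funext i; simp
    rw [Set.mem_ofPred_eq, ← e]; exact h1
  · have e : (fun i => (n • Fin.append α β) (Fin.natAdd m i)) = n • β := by funext i; simp
    rw [Set.mem_ofPred_eq, ← e]; exact h2

theorem isBohrZero_norm_fourier_sub_one_lt (θ : UnitAddCircle) {ε : ℝ} (hε : 0 < ε) :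
    IsBohrZero {z : ℤ | ‖fourier z θ - 1‖ < ε} := by
  refine ⟨1, fun _ => θ, {x | ‖(AddCircle.toCircle (x 0) : ℂ) - 1‖ < ε}, ?_, ?_, ?_⟩
  · refine isOpen_lt ?_ continuous_const
    have := AddCircle.continuous_toCircle (T := 1)
    fun_prop
  · simpa using hε
  · intro z hz
    simpa [fourier_apply] using hz

/-- Trigonometric polynomials are uniformly continuous for the Bohr topology. -/
theorem isBohrZero_almostPeriods {p : ℤ → ℝ} (hp : p ∈ trigPoly) :
    ∀ ε > 0, IsBohrZero {z | ∀ n, |p (n + z) - p n| ≤ ε} := by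
  have hchar : ∀ (θ : UnitAddCircle) (z n : ℤ),
      ‖fourier (n + z) θ - fourier n θ‖ = ‖fourier z θ - 1‖ := by
    intro θ z n
    rw [fourier_add, ← mul_sub_one, norm_mul, norm_fourier_apply, one_mul]
  induction hp using Submodule.span_induction with
  | mem p hp =>
    intro ε hε
    rcases hp with ⟨θ, rfl⟩ | ⟨θ, rfl⟩
    · refine (isBohrZero_norm_fourier_sub_one_lt θ hε).mono fun z hz n => ?_
      rw [cosChar, cosChar, ← Complex.sub_re]
      exact (Complex.abs_re_le_norm _).trans ((hchar θ z n).le.trans hz.le)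
    · refine (isBohrZero_norm_fourier_sub_one_lt θ hε).mono fun z hz n => ?_
      rw [sinChar, sinChar, ← Complex.sub_im]
      exact (Complex.abs_im_le_norm _).trans ((hchar θ z n).le.trans hz.le)
  | zero =>
    intro ε hε
    exact IsBohrZero.univ.mono fun z _ n => by simpa using hε.le
  | add p q _ _ ihp ihq =>
    intro ε hε
    refine ((ihp (ε / 2) (by positivity)).inter (ihq (ε / 2) (by positivity))).mono ?_
    rintro z ⟨h1, h2⟩ n
    have e : (p + q) (n + z) - (p + q) n = (p (n + z) - p n) + (q (n + z) - q n) := by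
      simp only [Pi.add_apply]; ring
    rw [e]
    exact (abs_add_le _ _).trans ((add_le_add (h1 n) (h2 n)).trans (add_halves ε).le)
  | smul c p _ ih =>
    intro ε hε
    refine (ih (ε / (|c| + 1)) (by positivity)).mono fun z hz n => ?_
    have e : (c • p) (n + z) - (c • p) n = c * (p (n + z) - p n) := by
      simp only [Pi.smul_apply, smul_eq_mul]; ring
    rw [e, abs_mul]
    calc |c| * |p (n + z) - p n| ≤ (|c| + 1) * (ε / (|c| + 1)) :=
          mul_le_mul (by linarith) (hz n) (abs_nonneg _) (by positivity)
      _ = ε := by field_simp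

/-- `p` is a trigonometric polynomial minimizing the mean square distance to `f` up to `η`. -/
def IsNearProj (M : (ℤ → ℝ) →ₗ[ℝ] ℝ) (f : ℤ → ℝ) (η : ℝ) (p : ℤ → ℝ) : Prop :=
  p ∈ trigPoly ∧ ∀ q ∈ trigPoly, M (fun n => (f n - p n) ^ 2) ≤ M (fun n => (f n - q n) ^ 2) + η

section NearProj

variable {M : (ℤ → ℝ) →ₗ[ℝ] ℝ} {f p q : ℤ → ℝ} {η κ : ℝ}

open IsInvMean

theorem exists_isNearProj (hM : IsInvMean M) (hf : IsBddSeq f) (hη : 0 < η) :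
    ∃ p, IsNearProj M f η p := by
  let S : Set ℝ := (fun q : ℤ → ℝ => M fun n => (f n - q n) ^ 2) '' trigPoly
  have hne : S.Nonempty := ⟨_, 0, trigPoly.zero_mem, rfl⟩
  have hbdd : BddBelow S := by
    refine ⟨0, ?_⟩
    rintro _ ⟨q, hq, rfl⟩
    exact hM.nonneg _ (hf.sub (isBddSeq_of_mem_trigPoly hq)).sq fun n => sq_nonneg _
  obtain ⟨_, ⟨p, hp, rfl⟩, hlt⟩ := exists_lt_of_csInf_lt hne (lt_add_of_pos_right (sInf S) hη)
  refine ⟨p, hp, fun q hq => ?_⟩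
  have := csInf_le hbdd ⟨q, hq, rfl⟩
  simp only at this hlt
  linarith

theorem IsNearProj.sq_map_mul_le (hp : IsNearProj M f η p) (hM : IsInvMean M)
    {ψ : ℤ → ℝ} (hψ : ψ ∈ trigPoly) (hψ1 : ∀ n, |ψ n| ≤ 1) :
    M (fun n => (f n - p n) * ψ n) ^ 2 ≤ η := by
  set t := M fun n => (f n - p n) * ψ n with ht
  have h := hp.2 (p + t • ψ) (trigPoly.add_mem hp.1 (trigPoly.smul_mem t hψ))
  have e : (fun n => (f n - (p + t • ψ) n) ^ 2) =
      fun n => ((f n - p n) ^ 2 - (2 * t) * ((f n - p n) * ψ n)) + t ^ 2 * ψ n ^ 2 := by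
    funext n; simp only [Pi.add_apply, Pi.smul_apply, smul_eq_mul]; ring
  rw [e, map_add, map_sub, map_const_mul, map_const_mul, ← ht] at h
  have h1 : M (fun n => ψ n ^ 2) ≤ 1 := by
    refine (le_abs_self _).trans (hM.abs_le fun n => ?_)
    rw [abs_pow]; exact pow_le_one₀ (abs_nonneg _) (hψ1 n)
  nlinarith [sq_nonneg t]

theorem IsNearProj.map_sub_sq_le (hp : IsNearProj M f η p) (hq : IsNearProj M f κ q) :
    M (fun n => (q n - p n) ^ 2) ≤ 2 * (η + κ) := by
  have hm : (1 / 2 : ℝ) • (p + q) ∈ trigPoly :=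
    trigPoly.smul_mem _ (trigPoly.add_mem hp.1 hq.1)
  have h1 := hp.2 _ hm
  have h2 := hq.2 _ hm
  have e : (fun n => (f n - ((1 / 2 : ℝ) • (p + q)) n) ^ 2) =
      fun n => ((1 / 2 : ℝ) * (f n - p n) ^ 2 + (1 / 2 : ℝ) * (f n - q n) ^ 2)
        - (1 / 4 : ℝ) * (q n - p n) ^ 2 := by
    funext n; simp only [Pi.add_apply, Pi.smul_apply, smul_eq_mul]; ring
  rw [e, map_sub, map_add, map_const_mul, map_const_mul, map_const_mul] at h1 h2
  linarith

theorem IsNearProj.le_map_mul (hp : IsNearProj M f η p) (hM : IsInvMean M) :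
    M f ^ 2 - η ≤ 2 * M fun n => f n * p n := by
  have h := hp.2 _ (const_mem_trigPoly (M f))
  have e1 : (fun n => (f n - p n) ^ 2) = fun n => (f n ^ 2 - 2 * (f n * p n)) + p n ^ 2 := by
    funext n; ring
  have e2 : (fun n => (f n - M f) ^ 2) = fun n => (f n ^ 2 - (2 * M f) * f n) + M f ^ 2 := by
    funext n; ring
  rw [e1, e2, map_add, map_sub, map_const_mul, map_add, map_sub, map_const_mul,
    hM.map_const] at h
  have h0 := hM.nonneg (fun n => p n ^ 2) (isBddSeq_of_mem_trigPoly hp.1).sq fun n => sq_nonneg _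
  nlinarith

end NearProj

theorem continuous_cosChar (n : ℤ) : Continuous fun θ => cosChar θ n :=
  Complex.continuous_re.comp (fourier n).continuous

theorem integrable_cosChar (μ : Measure UnitAddCircle) [IsFiniteMeasure μ] (n : ℤ) :
    Integrable (fun θ => cosChar θ n) μ :=
  Integrable.of_bound (continuous_cosChar n).aestronglyMeasurable 1
    (Eventually.of_forall fun θ => abs_cosChar_le θ n)

theorem cosChar_mul_cosChar (θ : UnitAddCircle) (m n : ℤ) :
    cosChar θ m * cosChar θ n = (cosChar θ (m - n) + cosChar θ (m - -n)) / 2 := by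
  have h : sinChar θ (-n) = -sinChar θ n := by simp [sinChar]
  rw [cosChar_sub, cosChar_sub, cosChar_neg, h]
  ring

theorem cosChar_zero (θ : UnitAddCircle) : cosChar θ 0 = 1 := by simp [cosChar]

theorem integral_cosChar_haar (n : ℤ) :
    ∫ θ, cosChar θ n ∂AddCircle.haarAddCircle = if n = 0 then 1 else 0 := by
  split_ifs with h
  · simp [h, cosChar_zero]
  · have h1 := integral_add_right_eq_self (μ := AddCircle.haarAddCircle)
      (fun θ : UnitAddCircle => cosChar θ n) ((1 / 2 / n : ℝ) : UnitAddCircle)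
    have h2 : ∀ θ : UnitAddCircle,
        cosChar (θ + ((1 / 2 / n : ℝ) : UnitAddCircle)) n = -cosChar θ n := by
      intro θ
      rw [cosChar, fourier_add_half_inv_index h one_pos, Complex.neg_re, cosChar]
    simp only [h2, integral_neg] at h1
    linarith

theorem sum_sum_ite_sub_eq (N k : ℕ) (hk : k ≤ N) (c : ℝ) :
    ∑ i ∈ Finset.range N, ∑ j ∈ Finset.range N, (if (i : ℤ) - j - k = 0 then c else 0)
      = ((N : ℝ) - k) * c := by
  have h : ∀ i ∈ Finset.range N, ∑ j ∈ Finset.range N, (if (i : ℤ) - j - k = 0 then c else 0)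
      = if k ≤ i then c else 0 := by
    intro i hi
    rw [Finset.mem_range] at hi
    split_ifs with hki
    · rw [Finset.sum_eq_single (i - k)]
      · rw [if_pos (by omega)]
      · intro j _ hj; rw [if_neg (by omega)]
      · intro hj; exact absurd (Finset.mem_range.2 (by omega)) hj
    · exact Finset.sum_eq_zero fun j _ => if_neg (by omega)
  rw [Finset.sum_congr rfl h, ← Finset.sum_filter]
  have h2 : (Finset.range N).filter (fun i => k ≤ i) = Finset.Ico k N := by
    ext i; simp; omega
  rw [h2, Finset.sum_const, Nat.card_Ico, nsmul_eq_mul, Nat.cast_sub hk]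

/-- A real positive definite sequence, tested on finitely many consecutive indices. -/
def IsPosDefSeq (γ : ℤ → ℝ) : Prop :=
  ∀ (N : ℕ) (c : ℕ → ℝ),
    0 ≤ ∑ i ∈ Finset.range N, ∑ j ∈ Finset.range N, c i * c j * γ ((i : ℤ) - j)

/-- The Fejér sums of the Fourier series with coefficients `γ`. -/
noncomputable def fejerSum (γ : ℤ → ℝ) (N : ℕ) (θ : UnitAddCircle) : ℝ :=
  (∑ i ∈ Finset.range N, ∑ j ∈ Finset.range N, γ ((i : ℤ) - j) * cosChar θ ((i : ℤ) - j)) / N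

theorem continuous_fejerSum (γ : ℤ → ℝ) (N : ℕ) : Continuous (fejerSum γ N) := by
  unfold fejerSum
  refine Continuous.div_const ?_ _
  exact continuous_finsetSum _ fun i _ => continuous_finsetSum _ fun j _ =>
    continuous_const.mul (continuous_cosChar _)

theorem IsPosDefSeq.fejerSum_nonneg {γ : ℤ → ℝ} (hγ : IsPosDefSeq γ) (N : ℕ) (θ : UnitAddCircle) :
    0 ≤ fejerSum γ N θ := by
  refine div_nonneg ?_ (Nat.cast_nonneg _)
  have h1 := hγ N fun i => cosChar θ i
  have h2 := hγ N fun i => sinChar θ i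
  have := add_nonneg h1 h2
  rw [← Finset.sum_add_distrib] at this
  convert this using 2
  rw [← Finset.sum_add_distrib]
  refine Finset.sum_congr rfl fun j _ => ?_
  rw [cosChar_sub]; ring

theorem integral_fejerSum_mul_cosChar {γ : ℤ → ℝ} (heven : ∀ z, γ (-z) = γ z) {N k : ℕ}
    (hk : k ≤ N) :
    ∫ θ, fejerSum γ N θ * cosChar θ k ∂AddCircle.haarAddCircle = ((N : ℝ) - k) / N * γ k := by
  have e : ∀ θ, fejerSum γ N θ * cosChar θ k = (∑ i ∈ Finset.range N, ∑ j ∈ Finset.range N,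
      (γ ((i : ℤ) - j) / (2 * N) * cosChar θ ((i : ℤ) - j - k) +
        γ ((i : ℤ) - j) / (2 * N) * cosChar θ ((i : ℤ) - j - -k))) := by
    intro θ
    rw [fejerSum, div_mul_eq_mul_div, Finset.sum_mul, Finset.sum_div]
    refine Finset.sum_congr rfl fun i _ => ?_
    rw [Finset.sum_mul, Finset.sum_div]
    refine Finset.sum_congr rfl fun j _ => ?_
    rw [mul_assoc, cosChar_mul_cosChar]; ring
  have hcos1 : ∀ (c : ℝ) (m : ℤ),
      Integrable (fun θ => c * cosChar θ m) AddCircle.haarAddCircle :=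
    fun c m => (integrable_cosChar _ m).const_mul c
  have hcos2 : ∀ (c : ℝ) (m n : ℤ),
      Integrable (fun θ => c * cosChar θ m + c * cosChar θ n) AddCircle.haarAddCircle :=
    fun c m n => (hcos1 c m).add (hcos1 c n)
  simp only [e]
  rw [integral_finsetSum _ fun i _ => integrable_finsetSum _ fun j _ => hcos2 _ _ _]
  have e2 : ∀ i ∈ Finset.range N, ∫ θ, ∑ j ∈ Finset.range N,
      (γ ((i : ℤ) - j) / (2 * N) * cosChar θ ((i : ℤ) - j - k) +
        γ ((i : ℤ) - j) / (2 * N) * cosChar θ ((i : ℤ) - j - -k)) ∂AddCircle.haarAddCircle =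
      ∑ j ∈ Finset.range N, (if (i : ℤ) - j - k = 0 then γ k / (2 * N) else 0) +
      ∑ j ∈ Finset.range N, (if (j : ℤ) - i - k = 0 then γ k / (2 * N) else 0) := by
    intro i _
    rw [integral_finsetSum _ fun j _ => hcos2 _ _ _, ← Finset.sum_add_distrib]
    refine Finset.sum_congr rfl fun j _ => ?_
    rw [integral_add (hcos1 _ _) (hcos1 _ _), integral_const_mul, integral_const_mul,
      integral_cosChar_haar, integral_cosChar_haar]
    congr 1
    · split_ifs with h
      · rw [show (i : ℤ) - j = k by omega, mul_one]
      · simp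
    · split_ifs with h h' h'
      · rw [show (i : ℤ) - j = -k by omega, heven, mul_one]
      · omega
      · omega
      · simp
  rw [Finset.sum_congr rfl e2, Finset.sum_add_distrib, sum_sum_ite_sub_eq N k hk,
    Finset.sum_comm, sum_sum_ite_sub_eq N k hk]
  ring

/-- **Herglotz's theorem** for real sequences. -/
theorem IsPosDefSeq.exists_measure {γ : ℤ → ℝ} (hγ : IsPosDefSeq γ) (heven : ∀ z, γ (-z) = γ z)
    (h0 : γ 0 = 1) :
    ∃ μ : ProbabilityMeasure UnitAddCircle, ∀ z, γ z = ∫ θ, cosChar θ z ∂(μ : Measure _) := by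
  let d : ℕ → UnitAddCircle → NNReal := fun N θ => (fejerSum γ (N + 1) θ).toNNReal
  have hd : ∀ N, Continuous (d N) := fun N => 
    continuous_real_toNNReal.comp (continuous_fejerSum γ (N + 1))
  let ν : ℕ → Measure UnitAddCircle := fun N =>
    AddCircle.haarAddCircle.withDensity fun θ => (d N θ : ENNReal)
  have hνint : ∀ N (h : UnitAddCircle → ℝ),
      ∫ θ, h θ ∂ν N = ∫ θ, fejerSum γ (N + 1) θ * h θ ∂AddCircle.haarAddCircle := by
    intro N h
    rw [integral_withDensity_eq_integral_smul (hd N).measurable]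
    refine integral_congr_ae (Eventually.of_forall fun θ => ?_)
    simp only [d, NNReal.smul_def, smul_eq_mul, Real.coe_toNNReal _ (hγ.fejerSum_nonneg _ _)]
  have hνk : ∀ N k : ℕ, k ≤ N + 1 →
      ∫ θ, cosChar θ k ∂ν N = (((N + 1 : ℕ) : ℝ) - k) / (N + 1 : ℕ) * γ k := by
    intro N k hk
    rw [hνint, integral_fejerSum_mul_cosChar heven hk]
  have hprob : ∀ N, IsProbabilityMeasure (ν N) := by
    intro N
    have h1 := hνk N 0 (by omega)
    have hN : ((N + 1 : ℕ) : ℝ) ≠ 0 := by positivity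
    simp only [Nat.cast_zero, cosChar_zero, sub_zero, div_self hN, h0, integral_const,
      smul_eq_mul, mul_one] at h1
    refine ⟨?_⟩
    rw [Measure.real] at h1
    exact (ENNReal.toReal_eq_one_iff _).1 h1
  let P : ℕ → ProbabilityMeasure UnitAddCircle := fun N => ⟨ν N, hprob N⟩
  obtain ⟨μ, -, hμ⟩ := isCompact_univ.ultrafilter_le_nhds ((hyperfilter ℕ).map P) (by simp)
  have hμ' : Tendsto P (hyperfilter ℕ : Ultrafilter ℕ) (𝓝 μ) := hμ
  have hU : ((hyperfilter ℕ : Ultrafilter ℕ) : Filter ℕ) ≤ atTop := by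
    rw [← Nat.cofinite_eq_atTop]; exact hyperfilter_le_cofinite
  rw [ProbabilityMeasure.tendsto_iff_forall_integral_tendsto] at hμ'
  have hnat : ∀ k : ℕ, γ k = ∫ θ, cosChar θ k ∂(μ : Measure _) := by
    intro k
    have h1 := hμ' (BoundedContinuousFunction.mkOfCompact ⟨_, continuous_cosChar k⟩)
    have h2 : Tendsto (fun N : ℕ => (((N + 1 : ℕ) : ℝ) - k) / (N + 1 : ℕ) * γ k) atTop
        (𝓝 ((1 - 0) * γ k)) := by
      refine Tendsto.mul_const _ ?_
      have h3 : Tendsto (fun N : ℕ => (k : ℝ) / ((N + 1 : ℕ) : ℝ)) atTop (𝓝 0) :=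
        (tendsto_natCast_atTop_atTop.comp (tendsto_add_atTop_nat 1)).const_div_atTop _
      refine (tendsto_const_nhds.sub h3).congr fun N => ?_
      rw [sub_div, div_self]; positivity
    rw [sub_zero, one_mul] at h2
    refine tendsto_nhds_unique ((h2.mono_left hU).congr' ?_) h1
    filter_upwards [hU (eventually_ge_atTop k)] with N hN
    exact (hνk N k (by omega)).symm
  refine ⟨μ, fun z => ?_⟩
  obtain ⟨k, rfl | rfl⟩ := z.eq_nat_or_neg
  · exact hnat k
  · simp only [cosChar_neg]
    rw [heven]; exact hnat k

theorem continuous_sinChar (n : ℤ) : Continuous fun θ => sinChar θ n :=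
  Complex.continuous_im.comp (fourier n).continuous

theorem cosChar_sub_left (θ φ : UnitAddCircle) (n : ℤ) :
    cosChar (θ - φ) n = cosChar θ n * cosChar φ n + sinChar θ n * sinChar φ n := by
  have h : fourier n (θ - φ) = fourier n θ * (starRingEnd ℂ) (fourier n φ) := by
    rw [← fourier_neg, fourier_apply, fourier_apply, fourier_apply, smul_sub, sub_eq_add_neg,
      neg_smul, AddCircle.toCircle_add, Circle.coe_mul]
  simp only [cosChar, sinChar, h, Complex.mul_re, Complex.conj_re, Complex.conj_im]
  ring

/-- The size of the sum of the first `R` powers of `e(θ)`. -/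
noncomputable def dirichletSize (R : ℕ) (θ : UnitAddCircle) : ℝ :=
  ‖∑ i ∈ Finset.range R, fourier 1 θ ^ i‖

theorem continuous_dirichletSize (R : ℕ) : Continuous (dirichletSize R) := by
  unfold dirichletSize
  exact (continuous_finsetSum _ fun i _ => (fourier 1).continuous.pow i).norm

theorem dirichletSize_le (R : ℕ) (θ : UnitAddCircle) : dirichletSize R θ ≤ R := by
  refine (norm_sum_le _ _).trans ?_
  simp only [norm_pow, norm_fourier_apply]
  simp

theorem fourier_one_pow (θ : UnitAddCircle) (i : ℕ) : fourier 1 θ ^ i = fourier (i : ℤ) θ := by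
  induction i with
  | zero => simp
  | succ i ih => rw [pow_succ, ih, Nat.cast_succ, fourier_add]

theorem sum_cosChar_le_dirichletSize (R : ℕ) (θ : UnitAddCircle) (n : ℤ) :
    ∑ i ∈ Finset.range R, cosChar θ (n + i) ≤ dirichletSize R θ := by
  have h : ∑ i ∈ Finset.range R, cosChar θ (n + i) =
      (fourier n θ * ∑ i ∈ Finset.range R, fourier 1 θ ^ i).re := by
    rw [Finset.mul_sum, Complex.re_sum]
    refine Finset.sum_congr rfl fun i _ => ?_
    rw [fourier_one_pow, ← fourier_add, cosChar]
  rw [h]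
  refine (Complex.re_le_norm _).trans ?_
  rw [norm_mul, norm_fourier_apply, one_mul, dirichletSize]

theorem tendsto_dirichletSize_div (θ : UnitAddCircle) :
    Tendsto (fun R : ℕ => dirichletSize R θ / R) atTop
      (𝓝 (({0} : Set UnitAddCircle).indicator 1 θ)) := by
  by_cases h : θ = 0
  · subst h
    simp only [Set.indicator_of_mem, Set.mem_singleton_iff, Pi.one_apply]
    refine tendsto_const_nhds.congr' ?_
    filter_upwards [eventually_gt_atTop 0] with R hR
    have : dirichletSize R 0 = R := by simp [dirichletSize]
    rw [this, div_self]
    positivity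
  · have hne : fourier 1 θ ≠ 1 := by
      intro h1
      rw [fourier_one] at h1
      have h2 : AddCircle.toCircle θ = AddCircle.toCircle (0 : UnitAddCircle) := by
        ext; simpa using h1
      exact h (AddCircle.injective_toCircle one_ne_zero h2)
    simp only [Set.mem_singleton_iff, h, not_false_eq_true, Set.indicator_of_notMem]
    refine squeeze_zero (fun R => div_nonneg (norm_nonneg _) (Nat.cast_nonneg _)) (fun R => ?_)
      (tendsto_natCast_atTop_atTop.const_div_atTop (2 / ‖fourier 1 θ - 1‖))
    refine div_le_div_of_nonneg_right ?_ (Nat.cast_nonneg _)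
    rw [dirichletSize, geom_sum_eq hne, norm_div]
    refine div_le_div_of_nonneg_right ?_ (norm_nonneg _)
    refine (norm_sub_le _ _).trans ?_
    rw [norm_pow, norm_fourier_apply]; norm_num

/-- The Fourier coefficients of a measure with small atoms are small on average (Wiener). -/
theorem exists_window_sum_sq_le (ν : Measure UnitAddCircle) [IsFiniteMeasure ν]
    (hν1 : ν Set.univ ≤ 1) {κ : ℝ} (hκ : 0 < κ) (hatom : ∀ θ, ν {θ} ≤ ENNReal.ofReal κ) :
    ∃ R : ℕ, 0 < R ∧ ∀ n : ℤ,
      ∑ i ∈ Finset.range R, (∫ θ, cosChar θ (n + i) ∂ν) ^ 2 ≤ R * (2 * κ) := by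
  let D : Set (UnitAddCircle × UnitAddCircle) := {x | x.1 = x.2}
  have hDm : MeasurableSet D := (isClosed_eq continuous_fst continuous_snd).measurableSet
  have hD : (ν.prod ν) D ≤ ENNReal.ofReal κ := by
    rw [Measure.prod_apply hDm]
    calc ∫⁻ θ, ν (Prod.mk θ ⁻¹' D) ∂ν ≤ ∫⁻ _, ENNReal.ofReal κ ∂ν := by
          refine lintegral_mono fun θ => ?_
          have : Prod.mk θ ⁻¹' D = {θ} := by ext φ; simp [D, eq_comm]
          rw [this]; exact hatom θ
      _ = ENNReal.ofReal κ * ν Set.univ := lintegral_const _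
      _ ≤ ENNReal.ofReal κ := mul_le_of_le_one_right' hν1
  have hlim : Tendsto (fun R : ℕ => ∫ x : UnitAddCircle × UnitAddCircle,
      dirichletSize R (x.1 - x.2) / R ∂(ν.prod ν)) atTop
      (𝓝 (∫ x, D.indicator 1 x ∂(ν.prod ν))) := by
    refine tendsto_integral_of_dominated_convergence (fun _ => 1) (fun R => ?_)
      (integrable_const _) (fun R => Eventually.of_forall fun x => ?_)
      (Eventually.of_forall fun x => ?_)
    · exact (((continuous_dirichletSize R).comp (continuous_fst.sub continuous_snd)).div_const
        _).aestronglyMeasurable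
    · rw [Real.norm_eq_abs, abs_of_nonneg (div_nonneg (show 0 ≤ dirichletSize R _ from norm_nonneg _)
        (Nat.cast_nonneg _))]
      exact div_le_one_of_le₀ (dirichletSize_le _ _) (Nat.cast_nonneg _)
    · convert tendsto_dirichletSize_div (x.1 - x.2) using 2
      by_cases h : x.1 = x.2
      · simp [D, h]
      · simp [D, h, sub_eq_zero]
  have hlt : ∫ x, D.indicator 1 x ∂(ν.prod ν) < 2 * κ := by
    rw [integral_indicator_one hDm, Measure.real]
    have := ENNReal.toReal_mono ENNReal.ofReal_ne_top hD
    rw [ENNReal.toReal_ofReal hκ.le] at this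
    linarith
  obtain ⟨R, hR, hR0⟩ := ((hlim.eventually (gt_mem_nhds hlt)).and (eventually_gt_atTop 0)).exists
  have hRpos : (0 : ℝ) < R := by exact_mod_cast hR0
  refine ⟨R, hR0, fun n => ?_⟩
  have hbd : ∀ z : ℤ, Integrable (fun x : UnitAddCircle × UnitAddCircle => cosChar (x.1 - x.2) z)
      (ν.prod ν) := fun z =>
    Integrable.of_bound ((continuous_cosChar z).comp
      (continuous_fst.sub continuous_snd)).aestronglyMeasurable 1
      (Eventually.of_forall fun x => abs_cosChar_le _ z)
  have hsq : ∀ z : ℤ, (∫ θ, cosChar θ z ∂ν) ^ 2 ≤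
      ∫ x : UnitAddCircle × UnitAddCircle, cosChar (x.1 - x.2) z ∂(ν.prod ν) := by
    intro z
    have hs : Integrable (fun θ => sinChar θ z) ν :=
      Integrable.of_bound (continuous_sinChar z).aestronglyMeasurable 1
        (Eventually.of_forall fun θ => abs_sinChar_le θ z)
    have hc := integrable_cosChar ν z
    simp only [cosChar_sub_left]
    rw [integral_add (hc.mul_prod hc) (hs.mul_prod hs),
      integral_prod_mul (fun θ => cosChar θ z) (fun θ => cosChar θ z),
      integral_prod_mul (fun θ => sinChar θ z) (fun θ => sinChar θ z)]
    nlinarith [mul_self_nonneg (∫ θ, sinChar θ z ∂ν)]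
  calc ∑ i ∈ Finset.range R, (∫ θ, cosChar θ (n + i) ∂ν) ^ 2
      ≤ ∑ i ∈ Finset.range R, ∫ x : UnitAddCircle × UnitAddCircle,
          cosChar (x.1 - x.2) (n + i) ∂(ν.prod ν) := Finset.sum_le_sum fun i _ => hsq _
    _ = ∫ x : UnitAddCircle × UnitAddCircle,
          ∑ i ∈ Finset.range R, cosChar (x.1 - x.2) (n + i) ∂(ν.prod ν) :=
        (integral_finsetSum _ fun i _ => hbd _).symm
    _ ≤ ∫ x : UnitAddCircle × UnitAddCircle, R * (dirichletSize R (x.1 - x.2) / R)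
          ∂(ν.prod ν) := by
        refine integral_mono (integrable_finsetSum _ fun i _ => hbd _) ?_ fun x => ?_
        · refine Integrable.of_bound (((((continuous_dirichletSize R).comp
            (continuous_fst.sub continuous_snd)).div_const _).const_mul
              (R : ℝ)).aestronglyMeasurable) R (Eventually.of_forall fun x => ?_)
          rw [mul_div_cancel₀ _ hRpos.ne', Real.norm_eq_abs,
            abs_of_nonneg (show 0 ≤ dirichletSize R _ from norm_nonneg _)]
          exact dirichletSize_le _ _
        · simp only
          rw [mul_div_cancel₀ _ hRpos.ne']
          exact sum_cosChar_le_dirichletSize R _ n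
    _ ≤ R * (2 * κ) := by
        rw [integral_const_mul]
        exact mul_le_mul_of_nonneg_left hR.le hRpos.le

/-- A positive definite sequence is a trigonometric polynomial with nonnegative coefficients plus a
sequence that is small in mean square on long windows. -/
theorem IsPosDefSeq.exists_decomp {γ : ℤ → ℝ} (hγ : IsPosDefSeq γ) (heven : ∀ z, γ (-z) = γ z)
    (h0 : γ 0 = 1) {κ : ℝ} (hκ : 0 < κ) :
    ∃ (T : Finset UnitAddCircle) (w : UnitAddCircle → ℝ) (ρ : ℤ → ℝ),
      (∀ θ, 0 ≤ w θ) ∧ ∑ θ ∈ T, w θ ≤ 1 ∧ (∀ z, γ z = ∑ θ ∈ T, w θ * cosChar θ z + ρ z) ∧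
      IsBddSeq ρ ∧
      ∃ R : ℕ, 0 < R ∧ ∀ n : ℤ, ∑ i ∈ Finset.range R, ρ (n + i) ^ 2 ≤ R * κ := by
  obtain ⟨μ, hμ⟩ := hγ.exists_measure heven h0
  have hfin : {θ : UnitAddCircle | ENNReal.ofReal (κ / 2) ≤ (μ : Measure _) {θ}}.Finite :=
    Measure.finite_const_le_meas_of_disjoint_iUnion (μ : Measure UnitAddCircle)
      (by simpa using hκ) (fun θ => measurableSet_singleton θ)
      (fun a b hab => by simpa using hab) (measure_ne_top _ _)
  set T := hfin.toFinset with hT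
  have hTm : MeasurableSet (T : Set UnitAddCircle) := T.measurableSet
  obtain ⟨R, hR0, hR⟩ := exists_window_sum_sq_le ((μ : Measure UnitAddCircle).restrict (T : Set _)ᶜ)
    (by simpa using prob_le_one) (half_pos hκ) (by
      intro θ
      rw [Measure.restrict_apply (measurableSet_singleton θ)]
      by_cases hθ : θ ∈ T
      · have : {θ} ∩ (T : Set UnitAddCircle)ᶜ = ∅ := by
          ext φ; simp only [Set.mem_inter_iff, Set.mem_singleton_iff, Set.mem_compl_iff,
            Finset.mem_coe, Set.mem_empty_iff_false, iff_false, not_and, not_not]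
          rintro rfl; exact hθ
        rw [this]; simp
      · refine (measure_mono Set.inter_subset_left).trans ?_
        have : ¬ ENNReal.ofReal (κ / 2) ≤ (μ : Measure UnitAddCircle) {θ} := by
          simpa [hT] using hθ
        exact (not_le.1 this).le)
  refine ⟨T, fun θ => (μ : Measure UnitAddCircle).real {θ},
    fun z => ∫ θ in (T : Set UnitAddCircle)ᶜ, cosChar θ z ∂(μ : Measure UnitAddCircle),
    fun θ => measureReal_nonneg, ?_, fun z => ?_, ⟨1, fun z => ?_⟩, R, hR0,
    fun n => ?_⟩
  · rw [sum_measureReal_singleton]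
    exact measureReal_le_one
  · rw [hμ, ← integral_add_compl hTm (integrable_cosChar _ z),
      setIntegral_finset T (integrable_cosChar _ z).integrableOn]
    simp
  · refine (norm_integral_le_of_norm_le_const (C := 1) (f := fun θ => cosChar θ z)
      (Eventually.of_forall fun θ => abs_cosChar_le θ z)).trans ?_
    rw [one_mul]
    exact (ENNReal.toReal_mono ENNReal.one_ne_top (by simpa using prob_le_one)).trans
      ENNReal.toReal_one.le
  · have := hR n
    rwa [mul_div_cancel₀ _ (two_ne_zero' ℝ)] at this

section Correlation

variable {M : (ℤ → ℝ) →ₗ[ℝ] ℝ} {f g u : ℤ → ℝ}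

open IsInvMean

/-- The correlation sequence `s ↦ M_n (f n * g (n - s))`. -/
noncomputable def corr (M : (ℤ → ℝ) →ₗ[ℝ] ℝ) (f g : ℤ → ℝ) (s : ℤ) : ℝ :=
  M fun n => f n * g (n - s)

theorem isBddSeq_corr (hM : IsInvMean M) (hf : IsBddSeq f) (hg : IsBddSeq g) :
    IsBddSeq (corr M f g) := by
  obtain ⟨C, hC0, hC⟩ := hf.exists_pos
  obtain ⟨D, hD0, hD⟩ := hg.exists_pos
  refine hM.isBddSeq_map (C * D) fun s n => ?_
  rw [abs_mul]
  exact mul_le_mul (hC _) (hD _) (abs_nonneg _) hC0.le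

theorem map_mul_shift (hM : IsInvMean M) (hg : IsBddSeq g) (s t : ℤ) :
    M (fun n => g (n - s) * g (n - t)) = corr M g g (t - s) := by
  rw [corr, ← hM.shift _ (hg.mul (hg.comp (· - (t - s)))) (-s)]
  congr 1; funext n
  rw [show n + -s - (t - s) = n - t by ring, ← sub_eq_add_neg]

theorem corr_self_neg (hM : IsInvMean M) (hg : IsBddSeq g) (z : ℤ) :
    corr M g g (-z) = corr M g g z := by
  have h1 := map_mul_shift hM hg z 0
  have h2 := map_mul_shift hM hg 0 z
  simp only [zero_sub, sub_zero] at h1 h2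
  rw [← h1, ← h2]
  congr 1; funext n; ring

theorem isPosDefSeq_corr_self (hM : IsInvMean M) (hg : IsBddSeq g) :
    IsPosDefSeq (corr M g g) := by
  intro N c
  have h := hM.nonneg (fun n => (∑ i ∈ Finset.range N, c i * g (n - i)) ^ 2)
    (IsBddSeq.sum _ fun (i : ℕ) _ => (hg.comp (· - (i : ℤ))).const_mul (c i)).sq fun n => sq_nonneg _
  have e : (fun n : ℤ => (∑ i ∈ Finset.range N, c i * g (n - i)) ^ 2) = fun n =>
      ∑ i ∈ Finset.range N, ∑ j ∈ Finset.range N, c i * c j * (g (n - j) * g (n - i)) := by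
    funext n
    rw [sq, Finset.sum_mul_sum]
    refine Finset.sum_congr rfl fun i _ => Finset.sum_congr rfl fun j _ => ?_
    ring
  rw [e, map_sum] at h
  refine h.trans_eq (Finset.sum_congr rfl fun i _ => ?_)
  rw [map_sum]
  refine Finset.sum_congr rfl fun j _ => ?_
  rw [map_const_mul, map_mul_shift hM hg]

theorem map_finsetAvg (M : (ℤ → ℝ) →ₗ[ℝ] ℝ) (J : Finset ℤ) (w : ℤ → ℤ → ℝ) :
    M (fun n => finsetAvg J fun s => w s n) = finsetAvg J fun s => M (w s) := by
  unfold finsetAvg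
  simp only [div_eq_mul_inv]
  rw [map_mul_const, map_sum]

theorem finsetAvg_mul_const (J : Finset ℤ) (u : ℤ → ℝ) (c : ℝ) :
    finsetAvg J (fun s => u s * c) = finsetAvg J u * c := by
  simp only [finsetAvg, ← Finset.sum_mul]; ring

theorem finsetAvg_const_mul (J : Finset ℤ) (u : ℤ → ℝ) (c : ℝ) :
    finsetAvg J (fun s => c * u s) = c * finsetAvg J u := by
  simp only [finsetAvg, ← Finset.mul_sum]; ring

/-- A van der Corput type inequality with independent iterated means on the right-hand side. -/
theorem sq_map_mul_corr_le (hM : IsInvMean M) (hf : ∀ n, |f n| ≤ 1) (hg : IsBddSeq g)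
    (hu : IsBddSeq u) :
    M (fun s => u s * corr M f g s) ^ 2 ≤
      |M fun s => u s * M fun t => u t * corr M g g (t - s)| := by
  have hfb : IsBddSeq f := ⟨1, hf⟩
  obtain ⟨Cu, hCu0, hCu⟩ := hu.exists_pos
  obtain ⟨Cg, hCg0, hCg⟩ := hg.exists_pos
  have hcb := isBddSeq_corr hM hfb hg
  have hγb := isBddSeq_corr hM hg hg
  obtain ⟨C, hC0, hC⟩ := (hu.mul hcb).exists_pos
  obtain ⟨Cγ, hCγ0, hCγ⟩ := hγb.exists_pos
  set h0 : ℤ → ℝ := fun s => u s * corr M f g s with hh0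
  set h1 : ℤ → ℝ := fun s => u s * M fun t => u t * corr M g g (t - s) with hh1
  have hh0b : IsBddSeq h0 := hu.mul hcb
  have hh1b : IsBddSeq h1 := by
    refine hu.mul (hM.isBddSeq_map (Cu * Cγ) fun s t => ?_)
    rw [abs_mul]; exact mul_le_mul (hCu _) (hCγ _) (abs_nonneg _) hCu0.le
  let k : Finset ℤ → ℤ → ℝ := fun J t => finsetAvg J fun s => u s * (u t * corr M g g (t - s))
  have hkb : ∀ J, IsBddSeq (k J) := by
    intro J
    refine ⟨Cu * (Cu * Cγ), fun t => abs_finsetAvg_le (by positivity) fun s => ?_⟩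
    rw [abs_mul, abs_mul]
    exact mul_le_mul (hCu _) (mul_le_mul (hCu _) (hCγ _) (abs_nonneg _) hCu0.le) (by positivity)
      hCu0.le
  have hMk : ∀ J, M (k J) = finsetAvg J h1 := by
    intro J
    rw [map_finsetAvg M J fun s t => u s * (u t * corr M g g (t - s))]
    simp only [map_const_mul, hh1]
  let v : Finset ℤ → ℤ → ℝ := fun J n => finsetAvg J fun s => u s * g (n - s)
  have hvle : ∀ J n, |v J n| ≤ Cu * Cg := fun J n =>
    abs_finsetAvg_le (by positivity) fun s => by
      rw [abs_mul]; exact mul_le_mul (hCu _) (hCg _) (abs_nonneg _) hCu0.le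
  have hvb : ∀ J, IsBddSeq (v J) := fun J => ⟨_, hvle J⟩
  have hMfv : ∀ J, M (fun n => f n * v J n) = finsetAvg J h0 := by
    intro J
    have e : (fun n => f n * v J n) = fun n => finsetAvg J fun s => u s * (f n * g (n - s)) := by
      funext n
      rw [← finsetAvg_const_mul]
      congr 1; funext s; ring
    rw [e, map_finsetAvg M J fun s n => u s * (f n * g (n - s))]
    simp only [map_const_mul, hh0, corr]
  have hMvv : ∀ J K, M (fun n => v J n * v K n) = finsetAvg K (k J) := by
    intro J K
    have e : (fun n => v J n * v K n) = fun n => finsetAvg K fun t => finsetAvg J fun s =>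
        u s * (u t * (g (n - s) * g (n - t))) := by
      funext n
      rw [← finsetAvg_const_mul]
      congr 1; funext t
      rw [← finsetAvg_mul_const]
      congr 1; funext s; ring
    rw [e, map_finsetAvg M K fun t n => finsetAvg J fun s => u s * (u t * (g (n - s) * g (n - t)))]
    congr 1; funext t
    rw [map_finsetAvg M J fun s n => u s * (u t * (g (n - s) * g (n - t)))]
    congr 1; funext s
    rw [map_const_mul, map_const_mul, map_mul_shift hM hg]
  set β := M h0
  set τ := M h1
  have hβ : |β| ≤ C := hM.abs_le hC
  have key : ∀ R : ℕ, 0 < R → β ^ 2 ≤ |τ| + ((Cu * Cg) ^ 2 + 2 + 2 * C) / R := by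
    intro R hR
    have hRpos : (0 : ℝ) < R := by exact_mod_cast hR
    classical
    obtain ⟨J, hJP, hJr⟩ := exists_seq_of_forall_finset_exists
      (fun J : Finset ℤ => |finsetAvg J h0 - β| ≤ 1 / R ∧ |finsetAvg J h1 - τ| ≤ 1 / R)
      (fun J K => |finsetAvg K (k J) - M (k J)| ≤ 1 / R) (by
        intro S _
        obtain ⟨K, hK⟩ := hM.approx (insert h0 (insert h1 (S.image k))) (by
          intro w hw
          simp only [Finset.mem_insert, Finset.mem_image] at hw
          rcases hw with rfl | rfl | ⟨J, -, rfl⟩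
          exacts [hh0b, hh1b, hkb J]) (1 / R) (by positivity)
        exact ⟨K, ⟨hK h0 (by simp), hK h1 (by simp)⟩, fun J hJ =>
          hK (k J) (by
            simp only [Finset.mem_insert, Finset.mem_image]
            exact .inr (.inr ⟨J, hJ, rfl⟩))⟩)
    have hoff : ∀ i j, i < j → M (fun n => v (J i) n * v (J j) n) ≤ |τ| + 2 / R := by
      intro i j hij
      have e1 := (abs_le.1 (hJr i j hij)).2
      have e2 := (abs_le.1 (hJP i).2).2
      rw [hMk] at e1
      rw [hMvv]
      have : (2 : ℝ) / R = 1 / R + 1 / R := by ring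
      linarith [le_abs_self τ]
    have hdiag : ∀ i, M (fun n => v (J i) n * v (J i) n) ≤ (Cu * Cg) ^ 2 := by
      intro i
      refine (le_abs_self _).trans (hM.abs_le fun n => ?_)
      rw [abs_mul, sq]
      exact mul_le_mul (hvle _ _) (hvle _ _) (abs_nonneg _) (by positivity)
    have hall : ∀ i j, M (fun n => v (J i) n * v (J j) n) ≤
        (|τ| + 2 / R) + (if i = j then (Cu * Cg) ^ 2 else 0) := by
      intro i j
      split_ifs with hij
      · subst hij
        have : 0 ≤ |τ| + 2 / R := by positivity
        linarith [hdiag i]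
      · rw [add_zero]
        rcases lt_or_gt_of_ne hij with h | h
        · exact hoff i j h
        · simpa only [mul_comm] using hoff j i h
    set V : ℤ → ℝ := fun n => ∑ i ∈ Finset.range R, v (J i) n with hV
    have hVb : IsBddSeq V := IsBddSeq.sum _ fun i _ => hvb (J i)
    have hMV : M (fun n => V n ^ 2) ≤ R * (R * (|τ| + 2 / R)) + R * (Cu * Cg) ^ 2 := by
      have e : (fun n => V n ^ 2) = fun n => ∑ i ∈ Finset.range R, ∑ j ∈ Finset.range R,
          v (J i) n * v (J j) n := by
        funext n; rw [sq, hV, Finset.sum_mul_sum]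
      rw [e, map_sum]
      calc _ = ∑ i ∈ Finset.range R, ∑ j ∈ Finset.range R, M (fun n => v (J i) n * v (J j) n) :=
            Finset.sum_congr rfl fun i _ => IsInvMean.map_sum _ _ _
        _ ≤ ∑ i ∈ Finset.range R, ∑ j ∈ Finset.range R,
            ((|τ| + 2 / R) + (if i = j then (Cu * Cg) ^ 2 else 0)) :=
            Finset.sum_le_sum fun i _ => Finset.sum_le_sum fun j _ => hall i j
        _ = _ := by
            simp only [Finset.sum_add_distrib]
            congr 1
            · simp; ring
            · rw [Finset.sum_congr rfl fun i hi => by rw [Finset.sum_ite_eq, if_pos hi]]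
              simp
    have hMfV : M (fun n => f n * V n) = ∑ i ∈ Finset.range R, finsetAvg (J i) h0 := by
      simp only [hV, Finset.mul_sum]
      rw [map_sum M (Finset.range R) fun i n => f n * v (J i) n]
      exact Finset.sum_congr rfl fun i _ => hMfv _
    have hCS := hM.sq_map_mul_le hfb hVb
    have hf2 : M (fun n => f n ^ 2) ≤ 1 := by
      refine (le_abs_self _).trans (hM.abs_le fun n => ?_)
      rw [abs_pow]; exact pow_le_one₀ (abs_nonneg _) (hf n)
    have hV0 : 0 ≤ M (fun n => V n ^ 2) := hM.nonneg _ hVb.sq fun n => sq_nonneg _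
    have hCS' : M (fun n => f n * V n) ^ 2 ≤ M (fun n => V n ^ 2) := by nlinarith
    have hdist : |M (fun n => f n * V n) - R * β| ≤ 1 := by
      rw [hMfV]
      have : ∑ i ∈ Finset.range R, finsetAvg (J i) h0 - R * β =
          ∑ i ∈ Finset.range R, (finsetAvg (J i) h0 - β) := by
        simp [Finset.sum_sub_distrib]
      rw [this]
      calc _ ≤ ∑ i ∈ Finset.range R, |finsetAvg (J i) h0 - β| := Finset.abs_sum_le_sum_abs _ _
        _ ≤ ∑ i ∈ Finset.range R, (1 / R : ℝ) := Finset.sum_le_sum fun i _ => (hJP i).1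
        _ = 1 := by simp; field_simp
    have hsz : |M (fun n => f n * V n)| ≤ R * C := by
      rw [hMfV]
      calc _ ≤ ∑ i ∈ Finset.range R, |finsetAvg (J i) h0| := Finset.abs_sum_le_sum_abs _ _
        _ ≤ ∑ i ∈ Finset.range R, C := Finset.sum_le_sum fun i _ => abs_finsetAvg_le hC0.le hC
        _ = R * C := by simp
    set X := M (fun n => f n * V n)
    have hXβ : (R * β) ^ 2 ≤ X ^ 2 + 2 * R * C := by
      have e : (R * β) ^ 2 - X ^ 2 = -(X - R * β) * (X + R * β) := by ring
      have h2 : |X + R * β| ≤ 2 * R * C := by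
        refine (abs_add_le _ _).trans ?_
        rw [abs_mul (R : ℝ), Nat.abs_cast]
        nlinarith
      have h3 : -(X - R * β) * (X + R * β) ≤ 1 * (2 * R * C) := by
        refine (le_abs_self _).trans ?_
        rw [abs_mul, abs_neg]
        exact mul_le_mul hdist h2 (abs_nonneg _) zero_le_one
      linarith
    have h4 : R * (R * (|τ| + 2 / R)) = R ^ 2 * |τ| + 2 * R := by field_simp
    have h5 : R ^ 2 * β ^ 2 ≤ R ^ 2 * (|τ| + ((Cu * Cg) ^ 2 + 2 + 2 * C) / R) := by
      have : (R : ℝ) ^ 2 * (|τ| + ((Cu * Cg) ^ 2 + 2 + 2 * C) / R) =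
          R ^ 2 * |τ| + R * ((Cu * Cg) ^ 2 + 2 + 2 * C) := by field_simp
      rw [this]
      nlinarith
    exact le_of_mul_le_mul_left h5 (by positivity)
  have hlim : Tendsto (fun R : ℕ => |τ| + ((Cu * Cg) ^ 2 + 2 + 2 * C) / R) atTop (𝓝 (|τ| + 0)) :=
    tendsto_const_nhds.add (tendsto_natCast_atTop_atTop.const_div_atTop _)
  rw [add_zero] at hlim
  refine ge_of_tendsto hlim ?_
  filter_upwards [eventually_gt_atTop 0] with R hR using key R hR

/-- A sequence with small Fourier coefficients nearly annihilates correlation sequences. -/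
theorem sq_map_mul_corr_le_of_fourier_small (hM : IsInvMean M) (hf : ∀ n, |f n| ≤ 1)
    (hg : IsBddSeq g) (hg0 : 0 < corr M g g 0) (hg1 : corr M g g 0 ≤ 1) (hu : IsBddSeq u) {η : ℝ}
    (hη : 0 ≤ η) (hcos : ∀ θ, M (fun n => u n * cosChar θ n) ^ 2 ≤ η)
    (hsin : ∀ θ, M (fun n => u n * sinChar θ n) ^ 2 ≤ η) :
    M (fun s => u s * corr M f g s) ^ 2 ≤ 2 * η := by
  refine (sq_map_mul_corr_le hM hf hg hu).trans ?_
  obtain ⟨C, hC0, hC⟩ := hu.exists_pos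
  set m := corr M g g 0 with hm
  have hpd : IsPosDefSeq fun z => corr M g g z / m := by
    intro N c
    have := div_nonneg (isPosDefSeq_corr_self hM hg N c) hg0.le
    simpa only [Finset.sum_div, mul_div_assoc] using this
  have key : ∀ κ > 0, |M fun s => u s * M fun t => u t * corr M g g (t - s)| ≤
      2 * η + C * (C * κ) := by
    intro κ hκ
    obtain ⟨T, w, ρ, hw0, hw1, hdec, hρb, R, hR0, hR⟩ := hpd.exists_decomp
      (fun z => by rw [corr_self_neg hM hg]) (div_self hg0.ne') (κ := κ ^ 2) (by positivity)
    have hρM : M (fun z => ρ z ^ 2) ≤ κ ^ 2 := hM.le_of_window_le hρb.sq hR0 hR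
    have hu2 : M (fun n => u n ^ 2) ≤ C ^ 2 := by
      refine (le_abs_self _).trans (hM.abs_le fun n => ?_)
      rw [abs_pow]; exact pow_le_pow_left₀ (abs_nonneg _) (hC n) 2
    have hρs : ∀ s, |M fun t => u t * ρ (t - s)| ≤ C * κ := by
      intro s
      have h1 := hM.sq_map_mul_le hu (hρb.comp (· - s))
      have h2 : M (fun t => ρ (t - s) ^ 2) = M (fun z => ρ z ^ 2) := hM.shift _ hρb.sq (-s)
      rw [h2] at h1
      have h3 : 0 ≤ M (fun z => ρ z ^ 2) := hM.nonneg _ hρb.sq fun n => sq_nonneg _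
      refine abs_le_of_sq_le_sq (h1.trans ?_) (by positivity)
      rw [mul_pow]
      exact mul_le_mul hu2 hρM h3 (by positivity)
    have hinner : ∀ s, M (fun t => u t * corr M g g (t - s)) =
        m * (∑ θ ∈ T, w θ * (M (fun n => u n * cosChar θ n) * cosChar θ s +
          M (fun n => u n * sinChar θ n) * sinChar θ s) + M fun t => u t * ρ (t - s)) := by
      intro s
      have e : (fun t => u t * corr M g g (t - s)) = fun t =>
          m * (∑ θ ∈ T, w θ * ((u t * cosChar θ t) * cosChar θ s +
            (u t * sinChar θ t) * sinChar θ s) + u t * ρ (t - s)) := by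
        funext t
        have h1 := hdec (t - s)
        rw [div_eq_iff hg0.ne'] at h1
        rw [h1, add_mul, mul_add, mul_add, Finset.mul_sum, Finset.sum_mul, Finset.mul_sum]
        congr 1
        · refine Finset.sum_congr rfl fun θ _ => ?_
          rw [cosChar_sub]; ring
        · ring
      rw [e, map_const_mul, map_add, IsInvMean.map_sum M T (fun θ t => w θ *
        ((u t * cosChar θ t) * cosChar θ s + (u t * sinChar θ t) * sinChar θ s))]
      simp only [map_const_mul, map_add, map_mul_const]
    have houter : (M fun s => u s * M fun t => u t * corr M g g (t - s)) =
        m * (∑ θ ∈ T, w θ * (M (fun n => u n * cosChar θ n) ^ 2 +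
          M (fun n => u n * sinChar θ n) ^ 2) + M fun s => u s * M fun t => u t * ρ (t - s)) := by
      have e : (fun s => u s * M fun t => u t * corr M g g (t - s)) = fun s =>
          m * (∑ θ ∈ T, w θ * (M (fun n => u n * cosChar θ n) * (u s * cosChar θ s) +
          M (fun n => u n * sinChar θ n) * (u s * sinChar θ s)) +
          u s * M fun t => u t * ρ (t - s)) := by
        funext s
        rw [hinner, mul_left_comm, mul_add, Finset.mul_sum]
        congr 2
        refine Finset.sum_congr rfl fun θ _ => ?_
        ring
      rw [e, map_const_mul, map_add, IsInvMean.map_sum M T (fun θ s => w θ *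
        (M (fun n => u n * cosChar θ n) * (u s * cosChar θ s) +
          M (fun n => u n * sinChar θ n) * (u s * sinChar θ s)))]
      simp only [map_const_mul, map_add, sq]
    have hS0 : 0 ≤ ∑ θ ∈ T, w θ * (M (fun n => u n * cosChar θ n) ^ 2 +
        M (fun n => u n * sinChar θ n) ^ 2) :=
      Finset.sum_nonneg fun θ _ => mul_nonneg (hw0 θ) (by positivity)
    have hS : ∑ θ ∈ T, w θ * (M (fun n => u n * cosChar θ n) ^ 2 +
        M (fun n => u n * sinChar θ n) ^ 2) ≤ 2 * η := by
      calc _ ≤ ∑ θ ∈ T, w θ * (2 * η) := Finset.sum_le_sum fun θ _ =>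
            mul_le_mul_of_nonneg_left (by linarith [hcos θ, hsin θ]) (hw0 θ)
        _ = (∑ θ ∈ T, w θ) * (2 * η) := (Finset.sum_mul _ _ _).symm
        _ ≤ 1 * (2 * η) := mul_le_mul_of_nonneg_right hw1 (by positivity)
        _ = 2 * η := one_mul _
    have hlast : |M fun s => u s * M fun t => u t * ρ (t - s)| ≤ C * (C * κ) :=
      hM.abs_le fun s => by
        rw [abs_mul]; exact mul_le_mul (hC s) (hρs s) (abs_nonneg _) hC0.le
    rw [houter, abs_mul, abs_of_pos hg0]
    refine (mul_le_of_le_one_left (abs_nonneg _) hg1).trans ((abs_add_le _ _).trans ?_)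
    rw [abs_of_nonneg hS0]
    exact add_le_add hS hlast
  refine le_of_forall_pos_le_add fun ε hε => ?_
  have := key (ε / (C * C)) (by positivity)
  have e : C * (C * (ε / (C * C))) = ε := by field_simp
  rwa [e] at this

end Correlation

section Blocks

variable {B : Set ℤ} {L : ℕ}

/-- The points of `B` that come first in their block `[tL, (t+1)L)`. -/
def blockFirst (B : Set ℤ) (L : ℕ) : Set ℤ :=
  {n | n ∈ B ∧ ¬ ∃ e ∈ B, e ≤ n - 1 ∧ e / L = n / L}

/-- The points preceded (weakly) by a point of `B` in their block. -/
def blockSeen (B : Set ℤ) (L : ℕ) : Set ℤ :=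
  {n | ∃ e ∈ B, e ≤ n ∧ e / L = n / L}

/-- The bounded discrepancy of the counting function of `blockFirst B L`. -/
noncomputable def blockDiscrepancy (B : Set ℤ) (L : ℕ) (n : ℤ) : ℝ :=
  ((n / L : ℤ) : ℝ) - n / L + (blockSeen B L).indicator 1 n

theorem isBddSeq_blockDiscrepancy (hL : 0 < L) : IsBddSeq (blockDiscrepancy B L) := by
  have hL' : (0 : ℝ) < L := by exact_mod_cast hL
  refine IsBddSeq.add ⟨1, fun n => ?_⟩ (IsBddSeq.indicator _)
  have h1 : ((n / L : ℤ) : ℝ) * L + ((n % L : ℤ) : ℝ) = n := by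
    exact_mod_cast Int.ediv_mul_add_emod n L
  have h2 : (0 : ℝ) ≤ ((n % L : ℤ) : ℝ) := by
    exact_mod_cast Int.emod_nonneg n (by omega)
  have h3 : ((n % L : ℤ) : ℝ) ≤ L := by
    exact_mod_cast (Int.emod_lt_of_pos n (by omega)).le
  have h4 : ((n / L : ℤ) : ℝ) - n / L = -(((n % L : ℤ) : ℝ) / L) := by
    field_simp; linarith
  simp only
  rw [h4, abs_neg, abs_of_nonneg (by positivity)]
  exact div_le_one_of_le₀ h3 hL'.le

theorem indicator_blockFirst_eq (hL : 0 < L) {n : ℤ}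
    (h : ∃ e ∈ B, n - L ≤ e ∧ e ≤ n - 1) :
    (blockFirst B L).indicator 1 n =
      (1 / L : ℝ) + (blockDiscrepancy B L n - blockDiscrepancy B L (n - 1)) := by
  have hL' : (L : ℝ) ≠ 0 := by positivity
  have hLz : (0 : ℤ) < L := by exact_mod_cast hL
  have e0 : (1 / L : ℝ) + (blockDiscrepancy B L n - blockDiscrepancy B L (n - 1)) =
      ((n / L : ℤ) : ℝ) - (((n - 1) / L : ℤ) : ℝ) + (blockSeen B L).indicator 1 n
        - (blockSeen B L).indicator 1 (n - 1) := by
    unfold blockDiscrepancy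
    push_cast
    field_simp
    ring
  rw [e0]
  by_cases hdiv : (n - 1) / (L : ℤ) = n / L
  · rw [hdiv, sub_self, zero_add]
    have hseen : n ∈ blockSeen B L ↔ n ∈ B ∨ n - 1 ∈ blockSeen B L := by
      constructor
      · rintro ⟨e, he, hen, hq⟩
        rcases hen.eq_or_lt with rfl | hlt
        · exact .inl he
        · exact .inr ⟨e, he, by omega, hq.trans hdiv.symm⟩
      · rintro (hn | ⟨e, he, hen, hq⟩)
        · exact ⟨n, hn, le_rfl, rfl⟩
        · exact ⟨e, he, by omega, hq.trans hdiv⟩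
    have hfirst : n ∈ blockFirst B L ↔ n ∈ B ∧ n - 1 ∉ blockSeen B L := by
      simp only [blockFirst, blockSeen, Set.mem_ofPred_eq, hdiv]
    by_cases h1 : n ∈ B <;> by_cases h2 : n - 1 ∈ blockSeen B L <;>
      simp [Set.indicator, hseen, hfirst, h1, h2]
  · have hmod : n % (L : ℤ) = 0 := by
      by_contra hne
      apply hdiv
      have h1 := Int.emod_nonneg n hLz.ne'
      have h2 := Int.emod_lt_of_pos n hLz
      have h3 := Int.ediv_mul_add_emod n L
      rw [Int.ediv_eq_iff_of_pos hLz]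
      constructor <;> nlinarith [h1.lt_of_ne' hne]
    obtain ⟨t, rfl⟩ := Int.dvd_of_emod_eq_zero hmod
    have hq : ∀ e : ℤ, L * t - L ≤ e → e ≤ L * t - 1 → e / (L : ℤ) = t - 1 := by
      intro e h1 h2
      rw [Int.ediv_eq_iff_of_pos hLz]
      constructor <;> nlinarith
    have ht : (L * t : ℤ) / L = t := Int.mul_ediv_cancel_left _ hLz.ne'
    have hnone : ∀ e : ℤ, e ≤ L * t - 1 → e / (L : ℤ) ≠ t := by
      intro e he hcon
      have := Int.mul_ediv_self_le (x := e) hLz.ne'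
      rw [hcon] at this
      omega
    have hprev : (L * t - 1 : ℤ) ∈ blockSeen B L := by
      obtain ⟨e, he, h1, h2⟩ := h
      exact ⟨e, he, h2, by rw [hq e h1 h2, hq _ (by omega) le_rfl]⟩
    have hseen : (L * t : ℤ) ∈ blockSeen B L ↔ (L * t : ℤ) ∈ B := by
      constructor
      · rintro ⟨e, he, hen, hqe⟩
        rcases hen.eq_or_lt with rfl | hlt
        · exact he
        · exact absurd (hqe.trans ht) (hnone e (by omega))
      · intro hn; exact ⟨_, hn, le_rfl, rfl⟩
    have hfirst : (L * t : ℤ) ∈ blockFirst B L ↔ (L * t : ℤ) ∈ B := by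
      constructor
      · exact fun h => h.1
      · refine fun h => ⟨h, ?_⟩
        rintro ⟨e, -, he, hqe⟩
        exact hnone e he (hqe.trans ht)
    rw [ht, hq _ (by omega) le_rfl]
    by_cases h1 : (L * t : ℤ) ∈ B <;> simp [Set.indicator, hseen, hfirst, h1, hprev]

end Blocks

section Step

variable {M : (ℤ → ℝ) →ₗ[ℝ] ℝ} {J : ℕ → Finset ℤ}

open IsInvMean

/-- The mean `M` only sees points deep inside the sets `J k`. -/
def IsDeep (M : (ℤ → ℝ) →ₗ[ℝ] ℝ) (J : ℕ → Finset ℤ) : Prop :=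
  ∀ (R : ℕ) (u : ℤ → ℝ), IsBddSeq u →
    (∀ n : ℤ, (∃ k, Finset.Icc (n - R) (n + R) ⊆ J k) → 0 ≤ u n) → 0 ≤ M u

theorem IsDeep.congr (hd : IsDeep M J) {u v : ℤ → ℝ} (hu : IsBddSeq u) (hv : IsBddSeq v) (R : ℕ)
    (h : ∀ n : ℤ, (∃ k, Finset.Icc (n - R) (n + R) ⊆ J k) → u n = v n) : M u = M v := by
  have h1 := hd R _ (hu.sub hv) fun n hn => by rw [h n hn, sub_self]
  have h2 := hd R _ (hv.sub hu) fun n hn => by rw [h n hn, sub_self]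
  rw [map_sub] at h1 h2
  linarith

/-- `B` meets every interval of length `L` contained in some `J k`. -/
def MeetsWindows (J : ℕ → Finset ℤ) (B : Set ℤ) (L : ℕ) : Prop :=
  ∀ (a : ℤ) (k : ℕ), Finset.Ico a (a + L) ⊆ J k → ∃ e ∈ B, e ∈ Finset.Ico a (a + L)

theorem corr_blockFirst (hd : IsDeep M J) {B : Set ℤ} {L : ℕ} (hL : 0 < L)
    (hB : MeetsWindows J B L) {h : ℤ → ℝ} (hh : IsBddSeq h) (s : ℤ) :
    corr M h ((blockFirst B L).indicator 1) s =
      M h / L + (corr M h (blockDiscrepancy B L) s - corr M h (blockDiscrepancy B L) (s + 1)) := by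
  have hφ := isBddSeq_blockDiscrepancy (B := B) hL
  have h1 : corr M h ((blockFirst B L).indicator 1) s = M fun n => h n * (1 / L) +
      (h n * blockDiscrepancy B L (n - s) - h n * blockDiscrepancy B L (n - (s + 1))) := by
    refine hd.congr (hh.mul ((IsBddSeq.indicator _).comp (· - s)))
      ((hh.mul (.const _)).add ((hh.mul (hφ.comp (· - s))).sub
        (hh.mul (hφ.comp (· - (s + 1)))))) (L + s.natAbs) ?_
    rintro n ⟨k, hk⟩
    have hsub : Finset.Ico (n - s - L) (n - s - L + L) ⊆ J k := by
      refine Finset.Subset.trans (fun x hx => ?_) hk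
      rw [Finset.mem_Ico] at hx
      rw [Finset.mem_Icc]
      push_cast
      have h1 := le_abs_self s
      have h2 := neg_abs_le s
      omega
    obtain ⟨e, he, hmem⟩ := hB (n - s - L) k hsub
    rw [Finset.mem_Ico] at hmem
    rw [indicator_blockFirst_eq hL ⟨e, he, by omega, by omega⟩,
      show n - (s + 1) = n - s - 1 by ring]
    ring
  rw [h1, IsInvMean.map_add, IsInvMean.map_sub, map_mul_const, mul_one_div]
  rfl

theorem map_corr_blockFirst (hM : IsInvMean M) (hd : IsDeep M J) {B : Set ℤ} {L : ℕ} (hL : 0 < L)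
    (hB : MeetsWindows J B L) {h : ℤ → ℝ} (hh : IsBddSeq h) :
    M (corr M h ((blockFirst B L).indicator 1)) = M h / L := by
  have hcb := isBddSeq_corr hM hh (isBddSeq_blockDiscrepancy (B := B) hL)
  have e : corr M h ((blockFirst B L).indicator 1) = fun s => M h / L +
      (corr M h (blockDiscrepancy B L) s - corr M h (blockDiscrepancy B L) (s + 1)) := by
    funext s; exact corr_blockFirst hd hL hB hh s
  rw [e, map_add, map_sub, hM.map_const, hM.shift _ hcb 1, sub_self, add_zero]

theorem map_indicator_blockFirst (hM : IsInvMean M) (hd : IsDeep M J) {B : Set ℤ} {L : ℕ}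
    (hL : 0 < L) (hB : MeetsWindows J B L) :
    M ((blockFirst B L).indicator 1) = 1 / L := by
  have h := map_corr_blockFirst hM hd hL hB (IsBddSeq.const 1)
  rw [hM.const_one] at h
  rw [← h, ← hM.map_const (M ((blockFirst B L).indicator 1))]
  congr 1
  funext s
  simp only [corr, one_mul]
  exact (hM.shift _ (IsBddSeq.indicator _) (-s)).symm

theorem map_indicator_finite (hM : IsInvMean M) (S : Finset ℤ) :
    M ((S : Set ℤ).indicator 1) ≤ 0 := by
  refine le_of_forall_pos_le_add fun κ hκ => ?_
  rw [zero_add]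
  obtain ⟨R, hR⟩ := exists_nat_gt (S.card / κ)
  have hR0 : (0 : ℝ) < R := lt_of_le_of_lt (by positivity) hR
  refine hM.le_of_window_le (IsBddSeq.indicator _) (R := R) (by exact_mod_cast hR0) fun n => ?_
  have h1 : ∑ i ∈ Finset.range R, (S : Set ℤ).indicator (1 : ℤ → ℝ) (n + i) ≤ S.card := by
    classical
    have e : ∑ i ∈ Finset.range R, (S : Set ℤ).indicator (1 : ℤ → ℝ) (n + i) =
        ((Finset.range R).filter fun i : ℕ => n + i ∈ S).card := by
      simp [Set.indicator]
    rw [e]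
    norm_cast
    refine Finset.card_le_card_of_injOn (fun i : ℕ => n + i) (fun i hi => ?_)
      (fun i _ j _ h => by simpa using h)
    exact (Finset.mem_filter.1 hi).2
  rw [div_lt_iff₀ hκ] at hR
  exact h1.trans hR.le

/-- If `E` meets every Bohr neighbourhood of `0` syndetically along `J`, then a set of positive mean
correlates with translates of `E` by its own elements. -/
theorem map_mul_corr_pos (hM : IsInvMean M) (hd : IsDeep M J) {E : Set ℤ}
    (hE : ∀ Λ, IsBohrZero Λ → ∃ L : ℕ, 0 < L ∧ MeetsWindows J (Λ ∩ E) L) {F : Set ℤ}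
    (hF : 0 < M (F.indicator 1)) :
    0 < M fun s => F.indicator 1 s * corr M (F.indicator 1) (E.indicator 1) s := by
  set f : ℤ → ℝ := F.indicator 1 with hf
  have hfb : IsBddSeq f := IsBddSeq.indicator _
  have hf01 : ∀ n, 0 ≤ f n ∧ f n ≤ 1 := fun n => by
    by_cases h : n ∈ F <;> simp [hf, h]
  have hfabs : ∀ n, |f n| ≤ 1 := fun n => by
    rw [abs_of_nonneg (hf01 n).1]; exact (hf01 n).2
  set δ := M f
  have hδ1 : δ ≤ 1 := (le_abs_self _).trans (hM.abs_le hfabs)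
  set ε := δ ^ 2 / 16 with hε
  have hε0 : 0 < ε := by positivity
  have hε1 : ε ≤ 1 := by nlinarith
  obtain ⟨p, hp⟩ := exists_isNearProj hM hfb (show 0 < ε ^ 2 by positivity)
  have hpb := isBddSeq_of_mem_trigPoly hp.1
  obtain ⟨L, hL, hB⟩ := hE _ (isBohrZero_almostPeriods hp.1 ε hε0)
  have hL' : (0 : ℝ) < L := by exact_mod_cast hL
  set B := {z | ∀ n, |p (n + z) - p n| ≤ ε} ∩ E
  set g : ℤ → ℝ := (blockFirst B L).indicator 1 with hg
  have hgb : IsBddSeq g := IsBddSeq.indicator _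
  have hg01 : ∀ n, 0 ≤ g n ∧ g n ≤ 1 := fun n => by
    by_cases h : n ∈ blockFirst B L <;> simp [hg, h]
  have hMg : M g = 1 / L := map_indicator_blockFirst hM hd hL hB
  have hMgs : ∀ s, M (fun n => g (n - s)) = 1 / L := fun s => by
    rw [← hMg]; exact hM.shift g hgb (-s)
  obtain ⟨q, hq⟩ := exists_isNearProj hM hfb
    (show 0 < min (ε ^ 2) ((ε / L) ^ 2 / 2) by positivity)
  have hqb := isBddSeq_of_mem_trigPoly hq.1
  set η := min (ε ^ 2) ((ε / L) ^ 2 / 2) with hη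
  have hη0 : 0 < η := by positivity
  set c := corr M f g with hc
  have hcb : IsBddSeq c := isBddSeq_corr hM hfb hgb
  have hc0 : ∀ s, 0 ≤ c s := fun s =>
    hM.nonneg _ (hfb.mul (hgb.comp (· - s))) fun n => mul_nonneg (hf01 n).1 (hg01 _).1
  have hc1 : ∀ s, c s ≤ 1 / L := fun s => by
    rw [← hMgs s]
    exact hM.mono (hfb.mul (hgb.comp (· - s))) (hgb.comp (· - s)) fun n =>
      mul_le_of_le_one_left (hg01 _).1 (hf01 n).2
  have hmain : M (fun s => p s * c s) ≥ M (fun n => f n * p n) / L - ε / L := by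
    rw [← map_corr_blockFirst hM hd hL hB (hfb.mul hpb), ← hM.map_const (ε / L), ← map_sub]
    refine hM.mono ((isBddSeq_corr hM (hfb.mul hpb) hgb).sub (.const _)) (hpb.mul hcb) fun s => ?_
    have h1 : M (fun n => f n * p n * g (n - s)) ≤
        M fun n => p s * (f n * g (n - s)) + ε * g (n - s) := by
      refine hM.mono ((hfb.mul hpb).mul (hgb.comp (· - s)))
        (((hfb.mul (hgb.comp (· - s))).const_mul _).add ((hgb.comp (· - s)).const_mul _))
        fun n => ?_
      by_cases hn : n - s ∈ blockFirst B L
      · have h2 := (abs_le.1 (hn.1.1 s)).2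
        rw [add_sub_cancel] at h2
        have h3 : g (n - s) = 1 := by simp [hg, hn]
        rw [h3]
        nlinarith [hf01 n]
      · have h3 : g (n - s) = 0 := by simp [hg, hn]
        simp [h3]
    rw [map_add, map_const_mul, map_const_mul, hMgs] at h1
    have h4 : ε * (1 / L) = ε / L := by ring
    rw [h4] at h1
    change M (fun n => f n * p n * g (n - s)) - ε / L ≤ p s * M fun n => f n * g (n - s)
    linarith
  have hsmall : |M fun s => (q s - p s) * c s| ≤ 2 * ε / L := by
    have hb := hqb.sub hpb
    have h1 : M (fun s => |q s - p s|) ≤ 2 * ε := by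
      have h2 := hM.sq_map_le hb.abs
      simp only [sq_abs] at h2
      have h3 := hp.map_sub_sq_le hq
      have h4 : η ≤ ε ^ 2 := min_le_left _ _
      refine le_of_sq_le_sq (h2.trans (h3.trans ?_)) (by positivity)
      nlinarith
    calc _ ≤ M fun s => |(q s - p s) * c s| := hM.abs_map_le (hb.mul hcb)
      _ ≤ M fun s => |q s - p s| * (1 / L) := by
          refine hM.mono (hb.mul hcb).abs (hb.abs.mul (.const _)) fun s => ?_
          rw [abs_mul, abs_of_nonneg (hc0 s)]
          exact mul_le_mul_of_nonneg_left (hc1 s) (abs_nonneg _)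
      _ = M (fun s => |q s - p s|) * (1 / L) := map_mul_const _ _ _
      _ ≤ 2 * ε * (1 / L) := mul_le_mul_of_nonneg_right h1 (by positivity)
      _ = 2 * ε / L := by ring
  have hunif : |M fun s => (f s - q s) * c s| ≤ ε / L := by
    have hgg : corr M g g 0 = 1 / L := by
      rw [← hMg]
      unfold corr
      congr 1
      funext n
      by_cases h : n ∈ blockFirst B L <;> simp [hg, h]
    have h1 := sq_map_mul_corr_le_of_fourier_small hM hfabs hgb (u := fun n => f n - q n)
      (by rw [hgg]; positivity)
      (by
        rw [hgg]
        exact div_le_one_of_le₀ (by exact_mod_cast hL) hL'.le)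
      (hfb.sub hqb) hη0.le
      (fun θ => hq.sq_map_mul_le hM (cosChar_mem_trigPoly θ) (abs_cosChar_le θ))
      (fun θ => hq.sq_map_mul_le hM (sinChar_mem_trigPoly θ) (abs_sinChar_le θ))
    refine abs_le_of_sq_le_sq (h1.trans ?_) (by positivity)
    have h4 : η ≤ (ε / L) ^ 2 / 2 := min_le_right _ _
    linarith
  have htotal : M (fun s => f s * c s) = M (fun s => p s * c s) + M (fun s => (q s - p s) * c s) +
      M (fun s => (f s - q s) * c s) := by
    rw [← map_add, ← map_add]
    congr 1; funext s; ring
  have hfp := hp.le_map_mul hM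
  have hpos : 0 < M (fun s => f s * c s) := by
    have h1 := (abs_le.1 hsmall).1
    have h2 := (abs_le.1 hunif).1
    have h3 : 7 * ε ≤ M (fun n => f n * p n) := by
      have : δ ^ 2 = 16 * ε := by rw [hε]; ring
      nlinarith
    have h4 : 7 * ε / L ≤ M (fun n => f n * p n) / L := div_le_div_of_nonneg_right h3 hL'.le
    have h5 : 7 * ε / L = 7 * (ε / L) := by ring
    have h6 : 2 * ε / L = 2 * (ε / L) := by ring
    have h7 : 0 < ε / L := by positivity
    rw [htotal]
    linarith
  refine hpos.trans_le (hM.mono (hfb.mul hcb) (hfb.mul (isBddSeq_corr hM hfb (.indicator _)))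
    fun s => mul_le_mul_of_nonneg_left ?_ (hf01 s).1)
  refine hM.mono (hfb.mul (hgb.comp (· - s))) (hfb.mul ((IsBddSeq.indicator E).comp (· - s)))
    fun n => mul_le_mul_of_nonneg_left ?_ (hf01 n).1
  exact Set.indicator_le_indicator_of_subset (fun n hn => hn.1.2) (fun _ => zero_le_one) _

theorem exists_mem_map_inter_pos (hM : IsInvMean M) (hd : IsDeep M J) {E : Set ℤ}
    (hE : ∀ Λ, IsBohrZero Λ → ∃ L : ℕ, 0 < L ∧ MeetsWindows J (Λ ∩ E) L) {F : Set ℤ}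
    (hF : 0 < M (F.indicator 1)) (hF0 : F ⊆ Set.Ioi 0) (N : ℤ) :
    ∃ s ∈ F, N < s ∧ 0 < M ((F ∩ {n | n - s ∈ E}).indicator 1) := by
  by_contra hcon
  push Not at hcon
  have hpos := map_mul_corr_pos hM hd hE hF
  refine absurd (hpos.trans_le ?_) (lt_irrefl 0)
  have hfb : IsBddSeq (F.indicator 1) := IsBddSeq.indicator _
  have hcorr : ∀ s, corr M (F.indicator 1) (E.indicator 1) s =
      M ((F ∩ {n | n - s ∈ E}).indicator 1) := by
    intro s
    unfold corr
    congr 1; funext n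
    by_cases h1 : n ∈ F <;> by_cases h2 : n - s ∈ E <;> simp [Set.indicator, h1, h2]
  refine le_trans ?_ (map_indicator_finite hM (Finset.Icc 1 N))
  refine hM.mono (hfb.mul (isBddSeq_corr hM hfb (.indicator _))) (.indicator _) fun s => ?_
  have hle1 : M ((F ∩ {n | n - s ∈ E}).indicator 1) ≤ 1 := by
    refine (le_abs_self _).trans (hM.abs_le fun n => ?_)
    by_cases h : n ∈ F ∩ {n | n - s ∈ E} <;> simp only [h, Set.indicator_of_mem,
      Set.indicator_of_notMem, not_false_eq_true] <;> simp
  rw [hcorr]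
  by_cases hs : s ∈ F
  · by_cases hN : N < s
    · have h1 := hcon s hs hN
      have h2 : (0 : ℝ) ≤ ((Finset.Icc 1 N : Finset ℤ) : Set ℤ).indicator 1 s :=
        Set.indicator_nonneg (fun _ _ => zero_le_one) _
      simp only [hs, Set.indicator_of_mem, Pi.one_apply, one_mul]
      linarith
    · have h0 : 0 < s := hF0 hs
      have hmem : s ∈ ((Finset.Icc 1 N : Finset ℤ) : Set ℤ) := by
        rw [Finset.mem_coe, Finset.mem_Icc]; omega
      rw [Set.indicator_of_mem hs, Set.indicator_of_mem hmem]
      simpa using hle1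
  · rw [Set.indicator_of_notMem hs, zero_mul]
    exact Set.indicator_nonneg (fun _ _ => zero_le_one) _

/-- A set meeting every Bohr neighbourhood of `0` syndetically along intervals contains the
difference set of an infinite set of positive integers. -/
theorem exists_infinite_differenceSet_subset (hM : IsInvMean M) (hd : IsDeep M J)
    (hJ : ∀ k, (J k : Set ℤ) ⊆ Set.Ioi 0) {E : Set ℤ}
    (hE : ∀ Λ, IsBohrZero Λ → ∃ L : ℕ, 0 < L ∧ MeetsWindows J (Λ ∩ E) L) :
    ∃ S : Set ℤ, S ⊆ Set.Ioi 0 ∧ S.Infinite ∧ differenceSet S ⊆ E := by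
  let X := {F : Set ℤ // F ⊆ Set.Ioi 0 ∧ 0 < M (F.indicator 1)}
  have hstep : ∀ x : X × ℤ, ∃ y : X × ℤ, y.2 ∈ x.1.1 ∧ x.2 < y.2 ∧
      y.1.1 = x.1.1 ∩ {n | n - y.2 ∈ E} := by
    rintro ⟨⟨F, hF0, hF⟩, N⟩
    obtain ⟨s, hs, hN, hpos⟩ := exists_mem_map_inter_pos hM hd hE hF hF0 N
    exact ⟨⟨⟨_, Set.inter_subset_left.trans hF0, hpos⟩, s⟩, hs, hN, rfl⟩
  choose step hmem hlt heq using hstep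
  have hstart : 0 < M ((Set.Ioi (0 : ℤ)).indicator 1) := by
    have : M ((Set.Ioi (0 : ℤ)).indicator 1) = M fun _ => 1 := by
      refine hd.congr (.indicator _) (.const 1) 0 ?_
      rintro n ⟨k, hk⟩
      have : n ∈ Set.Ioi (0 : ℤ) := hJ k (hk (by simp))
      rw [Set.indicator_of_mem this]; rfl
    rw [this, hM.const_one]; exact one_pos
  let x : ℕ → X × ℤ := fun n => step^[n] (⟨Set.Ioi 0, subset_rfl, hstart⟩, 0)
  have hx : ∀ n, x (n + 1) = step (x n) := fun n => Function.iterate_succ_apply' _ _ _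
  have hanti : Antitone fun n => (x n).1.1 := by
    refine antitone_nat_of_succ_le fun n => ?_
    rw [hx, heq]; exact Set.inter_subset_left
  have hmono : StrictMono fun n => (x n).2 := by
    refine strictMono_nat_of_lt_succ fun n => ?_
    rw [hx]; exact hlt _
  have hs : ∀ n, (x (n + 1)).2 ∈ (x n).1.1 := fun n => by rw [hx]; exact hmem _
  refine ⟨Set.range fun n => (x (n + 1)).2, ?_, ?_, ?_⟩
  · rintro _ ⟨n, rfl⟩
    exact (x n).1.2.1 (hs n)
  · exact Set.infinite_range_of_injective
      (hmono.comp (strictMono_nat_of_lt_succ fun n => Nat.lt_succ_self _)).injective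
  · rintro _ ⟨_, ⟨i, rfl⟩, _, ⟨j, rfl⟩, hij, rfl⟩
    have hij' : i + 1 ≤ j := by
      have := hmono.lt_iff_lt.1 hij
      omega
    have h1 : (x (j + 1)).2 ∈ (x (i + 1)).1.1 := hanti hij' (hs j)
    rw [hx i, heq, ← hx i] at h1
    exact h1.2

end Step

theorem mainTheorem3 (A : Set ℤ) (hA : IsDeltaStar A) :
    IsStronglyPiecewise IsBohrZero A := by
  intro J hJ hcard
  by_contra hcon
  have hE : ∀ Λ, IsBohrZero Λ → ∃ L : ℕ, 0 < L ∧ MeetsWindows J (Λ ∩ Aᶜ) L := by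
    intro Λ hΛ
    by_contra hno
    have hbad : ∀ j : ℕ, ∃ (a : ℤ) (k : ℕ), Finset.Ico a (a + (j + 1 : ℕ)) ⊆ J k ∧
        ∀ e ∈ Λ ∩ Aᶜ, e ∉ Finset.Ico a (a + (j + 1 : ℕ)) := by
      intro j
      by_contra hj
      refine hno ⟨j + 1, Nat.succ_pos j, fun a k hk => ?_⟩
      by_contra hne
      exact hj ⟨a, k, hk, fun e he hmem => hne ⟨e, he, hmem⟩⟩
    choose a k hk hdis using hbad
    have hIcc : ∀ j : ℕ, Finset.Icc (a j) (a j + j) = Finset.Ico (a j) (a j + (j + 1 : ℕ)) := by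
      intro j; ext n; simp only [Finset.mem_Icc, Finset.mem_Ico]; push_cast; omega
    refine hcon ⟨fun j => Finset.Icc (a j) (a j + j), fun j => ?_, fun j => ⟨k j, ?_⟩, ?_,
      Λ, hΛ, fun j n hn => ?_⟩
    · refine ⟨a j, a j + j, ?_, by omega, rfl⟩
      obtain ⟨l, r, hl, -, hJk⟩ := hJ (k j)
      have : a j ∈ J (k j) := hk j (by rw [Finset.mem_Ico]; push_cast; omega)
      rw [hJk, Finset.mem_Icc] at this
      omega
    · exact (hIcc j).trans_subset (hk j)
    · have : (fun j : ℕ => (Finset.Icc (a j) (a j + j)).card) = fun j => j + 1 := by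
        funext j; rw [Int.card_Icc]; omega
      rw [this]
      exact tendsto_add_atTop_nat 1
    · by_contra hnA
      refine hdis j n ⟨hn.1, hnA⟩ ?_
      rw [← hIcc]; exact Finset.mem_coe.1 hn.2
  obtain ⟨M, hM, hd⟩ := exists_isInvMean J hJ hcard
  obtain ⟨S, hS0, hSinf, hSE⟩ := exists_infinite_differenceSet_subset hM hd (fun k n hn => by
    obtain ⟨l, r, hl, -, hJk⟩ := hJ k
    rw [hJk, Finset.coe_Icc] at hn
    exact hl.trans_le hn.1) hE
  obtain ⟨n, hnA, hnS⟩ := hA S hS0 hSinf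
  exact hSE hnS hnA
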